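/- Let $X$ be a compact Riemann surface with canonical bundle $K$, equipped with a Kähler metric with area form $\sigma$. Let $Q=(V,E,h,t)$ be a finite quiver (an edge $a$ goes from $t(a)$ to $h(a)$), and let $(\mathcal{E}_v)_{v\in V}$ be smooth Hermitian complex vector bundles on $X$. Put $$\mathrm{Rep}(E(\overline{Q}))=\bigoplus_{a\in E}\Big(\Omega^0(X,\mathrm{Hom}(\mathcal{E}_{t(a)},\mathcal{E}_{h(a)}))\oplus\Omega^{0,1}(X,\mathrm{Hom}(\mathcal{E}_{h(a)},\mathcal{E}_{t(a)})\otimes K)\Big),$$ where $\Omega^{0,1}(X,W\otimes K)=\Omega^{1,1}(X,W)$ is the space of smooth $W$-valued two-forms. For a two-form $y_a$ write $y_a=(\star y_a)\,\sigma$, and let $y_a'^*y_a$ and $y_ay_a'^*$ denote the endomorphisms $(\star y_a')^*(\star y_a)$ and $(\star y_a)(\star y_a')^*$. Let $\mathcal{G}=\prod_v\mathrm{Aut}(\mathcal{E}_v)$ be the group of smooth unitary automorphisms, with Lie algebra $\mathfrak{g}$ (smooth skew-adjoint endomorphisms $\theta=(\theta_v)_v$), acting by $$g\cdot(x,y)=(g_{h(a)}x_ag_{t(a)}^{-1},\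 g_{t(a)}y_ag_{h(a)}^{-1})_a .$$ Consider the real and complex symplectic forms $$\omega_{\mathbb R}((x,y),(x',y'))=2\,\mathrm{Im}\sum_a\int_X\mathrm{tr}\big(x_ax_a'^*+y_a'^*y_a\big)\,\sigma,\qquad \omega_{\mathbb C}((x,y),(x',y'))=\sum_a\int_X\mathrm{tr}\big(x_ay_a'-x_a'y_a\big).$$ **Proposition.** The infinitesimal action of $\theta\in\mathfrak{g}$, $\frac{d}{dt}\big|_{t=0}\exp(t\theta)\cdot(x,y)$ (computed pointwise on $X$), is the vector field $$\xi_\theta(x,y)=(\theta_{h(a)}x_a-x_a\theta_{t(a)},\ \theta_{t(a)}y_a-y_a\theta_{h(a)})_a.$$ The forms $\omega_{\mathbb R}$ and $\omega_{\mathbb C}$ are, respectively, $\mathbb R$-bilinear and $\mathbb C$-bilinear, skew-symmetric, weakly non-degenerate and $\mathcal{G}$-invariant, and the $\mathcal{G}$-action is Hamiltonian for both, with moment maps whose components at the vertex $i$ are $$\mu_{\mathbb R}(x,y)_i=\sum_{h(a)=i}(x_ax_a^*-y_a^*y_a)-\sum_{t(a)=i}(x_a^*x_a-y_ay_a^*),\qquad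 \mu_{\mathbb C}(x,y)_i=\sum_{h(a)=i}x_ay_a-\sum_{t(a)=i}y_ax_a .$$ Explicitly: $\mu_{\mathbb R}(x,y)_i$ is a smooth self-adjoint endomorphism of $\mathcal{E}_i$ and $\mu_{\mathbb C}(x,y)_i$ is a smooth $\mathrm{End}(\mathcal{E}_i)$-valued two-form; with the pairings $$\langle\mu_{\mathbb R},\theta\rangle=\frac{1}{\sqrt{-1}}\sum_i\int_X\mathrm{tr}(\theta_i\,\mu_{\mathbb R,i})\,\sigma\in\mathbb R,\qquad \langle\mu_{\mathbb C},\theta\rangle=\sum_i\int_X\mathrm{tr}(\theta_i\,\mu_{\mathbb C,i})\in\mathbb C,$$ which are real-linear in $\theta\in\mathfrak{g}$, one has, for $\bullet\in\{\mathbb R,\mathbb C\}$, every point $z=(x,y)$, every direction $w$, every $\theta\in\mathfrak{g}$ and every $g\in\mathcal{G}$, $$d\langle\mu_\bullet,\theta\rangle_z(w)=\omega_\bullet(\xi_\theta(z),w),\qquad \langle\mu_\bullet(g\cdot z),\,g\theta g^{-1}\rangle=\langle\mu_\bullet(z),\theta\rangle .$$ Here $d\langle\mu_\bullet,\theta\rangle_z(w)$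 is the directional derivative, along a real parameter for $\bullet=\mathbb R$ and a complex one for $\bullet=\mathbb C$. -/

import Mathlib

open Set Bundle Manifold ContDiff

noncomputable section

namespace QuiverBundle

universe u v w

/-- The model fibre of a bundle of rank `r`. -/
abbrev ModelFiber (r : ℕ) : Type := EuclideanSpace ℂ (Fin r)

/-- A smooth Hermitian vector bundle (of constant rank) over a surface `X` with an atlas of
`ℂ`-valued charts. Only the underlying *real* smooth structure of `X` enters: the coordinate changes
are fibrewise `ℂ`-linear and smooth in the real sense, and the fibrewise Hermitian inner product
is smooth in local trivializations. -/
structure HermitianBundle (X : Type u) [TopologicalSpace X] [ChartedSpace ℂ X] where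
  rank : ℕ
  Fiber : X → Type v
  [normed : ∀ p, NormedAddCommGroup (Fiber p)]
  [innerProduct : ∀ p, InnerProductSpace ℂ (Fiber p)]
  [topTotal : TopologicalSpace (TotalSpace (ModelFiber rank) Fiber)]
  [fiberBundle : FiberBundle (ModelFiber rank) Fiber]
  [vectorBundle : VectorBundle ℂ (ModelFiber rank) Fiber]
  smooth_coordChange :
    ∀ (e e' : Trivialization (ModelFiber rank) (π (ModelFiber rank) Fiber))
      [MemTrivializationAtlas e] [MemTrivializationAtlas e'],
      ContMDiffOn 𝓘(ℝ, ℂ) 𝓘(ℝ, ModelFiber rank →L[ℂ] ModelFiber rank) ∞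
        (fun p => (e.coordChangeL ℂ e' p : ModelFiber rank →L[ℂ] ModelFiber rank))
        (e.baseSet ∩ e'.baseSet)
  smooth_metric :
    ∀ (e : Trivialization (ModelFiber rank) (π (ModelFiber rank) Fiber))
      [MemTrivializationAtlas e] (s t : ModelFiber rank),
      ContMDiffOn 𝓘(ℝ, ℂ) 𝓘(ℝ, ℂ) ∞
        (fun p => (inner ℂ (e.symm p s) (e.symm p t) : ℂ)) e.baseSet

attribute [instance] HermitianBundle.normed HermitianBundle.innerProduct
  HermitianBundle.topTotal HermitianBundle.fiberBundle HermitianBundle.vectorBundle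

variable {X : Type u} [TopologicalSpace X] [ChartedSpace ℂ X]

/-- The preferred local trivialization around `b`. -/
abbrev HermitianBundle.triv (E : HermitianBundle.{u, v} X) (b : X) :
    Trivialization (ModelFiber E.rank) (π (ModelFiber E.rank) E.Fiber) :=
  trivializationAt (ModelFiber E.rank) E.Fiber b

instance (E : HermitianBundle.{u, v} X) (p : X) : FiniteDimensional ℂ (E.Fiber p) :=
  LinearEquiv.finiteDimensional
    ((E.triv p).continuousLinearEquivAt ℂ p
      (FiberBundle.mem_baseSet_trivializationAt' p)).symm.toLinearEquiv

instance (E : HermitianBundle.{u, v} X) (p : X) : CompleteSpace (E.Fiber p) :=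
  FiniteDimensional.complete ℂ (E.Fiber p)

instance (r s : ℕ) : NormedSpace ℝ (ModelFiber r →L[ℂ] ModelFiber s) := NormedSpace.complexToReal

instance (E F : HermitianBundle.{u, v} X) (p : X) :
    NormedSpace ℝ (E.Fiber p →L[ℂ] F.Fiber p) := NormedSpace.complexToReal

instance (E : HermitianBundle.{u, v} X) (p : X) : ContinuousSMul ℂ (E.Fiber p) :=
  IsBoundedSMul.continuousSMul

instance (E F : HermitianBundle.{u, v} X) (p : X) :
    ContinuousSMul ℝ (E.Fiber p →L[ℂ] F.Fiber p) := IsBoundedSMul.continuousSMul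

/-- The matrix of a fibre map `A : E_p → F_p` in the trivializations of `E` around `b` and of `F`
around `c`. -/
def localRep (E F : HermitianBundle.{u, v} X) (b c p : X) (A : E.Fiber p →L[ℂ] F.Fiber p) :
    ModelFiber E.rank →L[ℂ] ModelFiber F.rank :=
  ContinuousLinearMap.inCoordinates (ModelFiber E.rank) E.Fiber (ModelFiber F.rank) F.Fiber
    b p c p A

/-- Smoothness over an open set `U` of a section of `Hom(E, F)`: it is smooth in local
trivializations. -/
def IsSmoothHomOn (E F : HermitianBundle.{u, v} X) (U : Set X)
    (x : ∀ p, E.Fiber p →L[ℂ] F.Fiber p) : Prop :=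
  ∀ b c : X, ContMDiffOn 𝓘(ℝ, ℂ) 𝓘(ℝ, ModelFiber E.rank →L[ℂ] ModelFiber F.rank) ∞
    (fun p => localRep E F b c p (x p)) (U ∩ ((E.triv b).baseSet ∩ (F.triv c).baseSet))

/-! ### Closure properties of smooth sections -/

section smooth

variable {E F G : HermitianBundle.{u, v} X} {U : Set X}

theorem localRep_add (b c p : X) (A B : E.Fiber p →L[ℂ] F.Fiber p) :
    localRep E F b c p (A + B) = localRep E F b c p A + localRep E F b c p B := by
  ext w; simp [localRep, ContinuousLinearMap.inCoordinates]

theorem localRep_smul (b c p : X) (k : ℂ) (A : E.Fiber p →L[ℂ] F.Fiber p) :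
    localRep E F b c p (k • A) = k • localRep E F b c p A := by
  ext w; simp [localRep, ContinuousLinearMap.inCoordinates]

theorem localRep_comp (b d c p : X) (hd : p ∈ (F.triv d).baseSet)
    (B : F.Fiber p →L[ℂ] G.Fiber p) (A : E.Fiber p →L[ℂ] F.Fiber p) :
    localRep E G b c p (B ∘L A) = localRep F G d c p B ∘L localRep E F b d p A := by
  ext1 w
  have h := Trivialization.symmL_continuousLinearMapAt (R := ℂ) (F.triv d) hd
    (A ((E.triv b).symmL ℂ p w))
  change _ = (G.triv c).continuousLinearMapAt ℂ p (B ((F.triv d).symmL ℂ p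
    ((F.triv d).continuousLinearMapAt ℂ p (A ((E.triv b).symmL ℂ p w)))))
  rw [h]
  rfl

theorem IsSmoothHomOn.add {x y : ∀ p, E.Fiber p →L[ℂ] F.Fiber p}
    (hx : IsSmoothHomOn E F U x) (hy : IsSmoothHomOn E F U y) :
    IsSmoothHomOn E F U (fun p => x p + y p) := by
  intro b c
  simp only [localRep_add]
  exact (hx b c).add (hy b c)

theorem IsSmoothHomOn.smul {f : X → ℂ} (hf : ContMDiffOn 𝓘(ℝ, ℂ) 𝓘(ℝ, ℂ) ∞ f U)
    {x : ∀ p, E.Fiber p →L[ℂ] F.Fiber p} (hx : IsSmoothHomOn E F U x) :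
    IsSmoothHomOn E F U (fun p => f p • x p) := by
  intro b c
  simp only [localRep_smul]
  have h : ContDiff ℝ ∞ (fun q : ℂ × (ModelFiber E.rank →L[ℂ] ModelFiber F.rank) => q.1 • q.2) :=
    contDiff_smul
  exact h.contMDiff.comp_contMDiffOn
    ((hf.mono inter_subset_left).prodMk_space (hx b c))

theorem IsSmoothHomOn.zero : IsSmoothHomOn E F U (fun _ => 0) := by
  intro b c
  have : ∀ p, localRep E F b c p 0 = 0 := fun p => by
    ext w; simp [localRep, ContinuousLinearMap.inCoordinates]
  simp only [this]
  exact contMDiffOn_const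

theorem IsSmoothHomOn.mono {V : Set X} (hUV : V ⊆ U) {x : ∀ p, E.Fiber p →L[ℂ] F.Fiber p}
    (hx : IsSmoothHomOn E F U x) : IsSmoothHomOn E F V x :=
  fun b c => (hx b c).mono (inter_subset_inter_left _ hUV)

theorem contMDiffOn_clmComp {r s t : ℕ} {S : Set X}
    {B : X → (ModelFiber s →L[ℂ] ModelFiber t)} {A : X → (ModelFiber r →L[ℂ] ModelFiber s)}
    (hB : ContMDiffOn 𝓘(ℝ, ℂ) 𝓘(ℝ, ModelFiber s →L[ℂ] ModelFiber t) ∞ B S)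
    (hA : ContMDiffOn 𝓘(ℝ, ℂ) 𝓘(ℝ, ModelFiber r →L[ℂ] ModelFiber s) ∞ A S) :
    ContMDiffOn 𝓘(ℝ, ℂ) 𝓘(ℝ, ModelFiber r →L[ℂ] ModelFiber t) ∞ (fun p => B p ∘L A p) S := by
  have h : ContDiff ℝ ∞ (fun q : (ModelFiber s →L[ℂ] ModelFiber t) ×
      (ModelFiber r →L[ℂ] ModelFiber s) => q.1 ∘L q.2) :=
    ((ContinuousLinearMap.compL ℂ (ModelFiber r) (ModelFiber s)
      (ModelFiber t)).bilinearRestrictScalars ℝ).isBoundedBilinearMap.contDiff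
  exact h.contMDiff.comp_contMDiffOn (hB.prodMk_space hA)

theorem IsSmoothHomOn.comp {y : ∀ p, F.Fiber p →L[ℂ] G.Fiber p}
    {x : ∀ p, E.Fiber p →L[ℂ] F.Fiber p}
    (hy : IsSmoothHomOn F G U y) (hx : IsSmoothHomOn E F U x) :
    IsSmoothHomOn E G U (fun p => y p ∘L x p) := by
  intro b c p hp
  have hpd : p ∈ (F.triv p).baseSet := FiberBundle.mem_baseSet_trivializationAt' p
  have key : ContMDiffOn 𝓘(ℝ, ℂ) 𝓘(ℝ, ModelFiber E.rank →L[ℂ] ModelFiber G.rank) ∞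
      (fun q => localRep E G b c q (y q ∘L x q))
      ((U ∩ ((E.triv b).baseSet ∩ (G.triv c).baseSet)) ∩ (F.triv p).baseSet) := by
    refine (contMDiffOn_clmComp ((hy p c).mono ?_) ((hx b p).mono ?_)).congr
      (fun q hq => localRep_comp b p c q hq.2 _ _)
    · rintro q ⟨⟨h1, h2, h3⟩, h4⟩; exact ⟨h1, h4, h3⟩
    · rintro q ⟨⟨h1, h2, h3⟩, h4⟩; exact ⟨h1, h2, h4⟩
  exact (contMDiffWithinAt_inter ((F.triv p).open_baseSet.mem_nhds hpd)).1 (key p ⟨hp, hpd⟩)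

theorem IsSmoothHomOn.id : IsSmoothHomOn E E U (fun p => ContinuousLinearMap.id ℂ (E.Fiber p)) := by
  intro b c
  refine ((E.smooth_coordChange (E.triv b) (E.triv c)).mono inter_subset_right).congr ?_
  rintro p ⟨-, hp⟩
  ext1 w
  rw [ContinuousLinearEquiv.coe_coe, Trivialization.coordChangeL_apply _ _ hp]
  change (E.triv c).continuousLinearMapAt ℂ p ((E.triv b).symmL ℂ p w) = _
  rw [Trivialization.continuousLinearMapAt_apply, Trivialization.coe_linearMapAt_of_mem _ hp.2,
    Trivialization.symmL_apply _ hp.1]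

/-- The Gram matrix of the Hermitian metric in a local trivialization. -/
def gram (E : HermitianBundle.{u, v} X) (b p : X) : ModelFiber E.rank →L[ℂ] ModelFiber E.rank :=
  ContinuousLinearMap.adjoint ((E.triv b).symmL ℂ p) ∘L (E.triv b).symmL ℂ p

theorem gram_smooth (b : X) :
    ContMDiffOn 𝓘(ℝ, ℂ) 𝓘(ℝ, ModelFiber E.rank →L[ℂ] ModelFiber E.rank) ∞
      (fun p => gram E b p) (E.triv b).baseSet := by
  let e := EuclideanSpace.basisFun (Fin E.rank) ℂ
  let K : Fin E.rank → Fin E.rank → (ModelFiber E.rank →L[ℂ] ModelFiber E.rank) :=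
    fun i j => (innerSL ℂ (e j)).smulRight (e i)
  have hsm : ContMDiffOn 𝓘(ℝ, ℂ) 𝓘(ℝ, ModelFiber E.rank →L[ℂ] ModelFiber E.rank) ∞
      (fun p => ∑ i, ∑ j, (inner ℂ ((E.triv b).symm p (e i)) ((E.triv b).symm p (e j)) : ℂ) •
        K i j) (E.triv b).baseSet := by
    refine contMDiffOn_finsetSum fun i _ => contMDiffOn_finsetSum fun j _ => ?_
    have h : ContDiff ℝ ∞ (fun q : ℂ => q • K i j) := contDiff_id.smul contDiff_const
    exact h.contMDiff.comp_contMDiffOn (E.smooth_metric (E.triv b) (e i) (e j))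
  refine hsm.congr fun p hp => ?_
  ext1 w
  rw [← e.sum_repr' (gram E b p w)]
  simp only [sum_apply]
  refine Finset.sum_congr rfl fun i _ => ?_
  have hw : gram E b p w = ∑ j, inner ℂ (e j) w • gram E b p (e j) := by
    conv_lhs => rw [← e.sum_repr' w]
    simp
  rw [hw, inner_sum, Finset.sum_smul]
  refine Finset.sum_congr rfl fun j _ => ?_
  have h2 : inner ℂ (e i) (gram E b p (e j)) =
      (inner ℂ ((E.triv b).symm p (e i)) ((E.triv b).symm p (e j)) : ℂ) := by
    change inner ℂ (e i) (ContinuousLinearMap.adjoint ((E.triv b).symmL ℂ p)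
      ((E.triv b).symmL ℂ p (e j))) = _
    rw [ContinuousLinearMap.adjoint_inner_right, Trivialization.symmL_apply _ hp,
      Trivialization.symmL_apply _ hp]
  rw [inner_smul_right, h2]
  simp [K, smul_smul, mul_comm]

theorem symm_comp_mapAt (b p : X) (hp : p ∈ (E.triv b).baseSet) :
    (E.triv b).symmL ℂ p ∘L (E.triv b).continuousLinearMapAt ℂ p =
      ContinuousLinearMap.id ℂ _ := by
  ext1 w
  exact Trivialization.symmL_continuousLinearMapAt (R := ℂ) (E.triv b) hp w

theorem mapAt_comp_symm (b p : X) (hp : p ∈ (E.triv b).baseSet) :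
    (E.triv b).continuousLinearMapAt ℂ p ∘L (E.triv b).symmL ℂ p =
      ContinuousLinearMap.id ℂ _ := by
  ext1 w
  exact Trivialization.continuousLinearMapAt_symmL (R := ℂ) (E.triv b) hp w

/-- The Gram matrix as a unit. -/
def gramUnit (E : HermitianBundle.{u, v} X) (b p : X) (hp : p ∈ (E.triv b).baseSet) :
    (ModelFiber E.rank →L[ℂ] ModelFiber E.rank)ˣ where
  val := gram E b p
  inv := (E.triv b).continuousLinearMapAt ℂ p ∘L
    ContinuousLinearMap.adjoint ((E.triv b).continuousLinearMapAt ℂ p)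
  val_inv := by
    change (ContinuousLinearMap.adjoint ((E.triv b).symmL ℂ p) ∘L (E.triv b).symmL ℂ p) ∘L
      ((E.triv b).continuousLinearMapAt ℂ p ∘L
        ContinuousLinearMap.adjoint ((E.triv b).continuousLinearMapAt ℂ p)) = _
    rw [ContinuousLinearMap.comp_assoc, ← ContinuousLinearMap.comp_assoc ((E.triv b).symmL ℂ p),
      symm_comp_mapAt b p hp, ContinuousLinearMap.id_comp, ← ContinuousLinearMap.adjoint_comp,
      mapAt_comp_symm b p hp]
    exact ContinuousLinearMap.adjoint_id
  inv_val := by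
    change ((E.triv b).continuousLinearMapAt ℂ p ∘L
        ContinuousLinearMap.adjoint ((E.triv b).continuousLinearMapAt ℂ p)) ∘L
      (ContinuousLinearMap.adjoint ((E.triv b).symmL ℂ p) ∘L (E.triv b).symmL ℂ p) = _
    rw [ContinuousLinearMap.comp_assoc, ← ContinuousLinearMap.comp_assoc
      (ContinuousLinearMap.adjoint ((E.triv b).continuousLinearMapAt ℂ p)),
      ← ContinuousLinearMap.adjoint_comp, symm_comp_mapAt b p hp, ContinuousLinearMap.adjoint_id,
      ContinuousLinearMap.id_comp, mapAt_comp_symm b p hp]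
    rfl

theorem gramInv_smooth (b : X) :
    ContMDiffOn 𝓘(ℝ, ℂ) 𝓘(ℝ, ModelFiber E.rank →L[ℂ] ModelFiber E.rank) ∞
      (fun p => Ring.inverse (gram E b p)) (E.triv b).baseSet := by
  intro p hp
  exact (contDiffAt_ringInverse ℝ (gramUnit E b p hp)).contMDiffAt.comp_contMDiffWithinAt p
    (gram_smooth b p hp)

theorem localRep_adjoint (b c p : X) (hb : p ∈ (E.triv b).baseSet) (hc : p ∈ (F.triv c).baseSet)
    (A : E.Fiber p →L[ℂ] F.Fiber p) :
    localRep F E c b p (ContinuousLinearMap.adjoint A) =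
      Ring.inverse (gram E b p) ∘L
        (ContinuousLinearMap.adjoint (localRep E F b c p A) ∘L gram F c p) := by
  have h1 : Ring.inverse (gram E b p) = (E.triv b).continuousLinearMapAt ℂ p ∘L
      ContinuousLinearMap.adjoint ((E.triv b).continuousLinearMapAt ℂ p) :=
    Ring.inverse_unit (gramUnit E b p hb)
  have h2 : localRep E F b c p A =
    (F.triv c).continuousLinearMapAt ℂ p ∘L (A ∘L (E.triv b).symmL ℂ p) := rfl
  have h3 : localRep F E c b p (ContinuousLinearMap.adjoint A) =
    (E.triv b).continuousLinearMapAt ℂ p ∘L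
      (ContinuousLinearMap.adjoint A ∘L (F.triv c).symmL ℂ p) := rfl
  have h4 : ContinuousLinearMap.adjoint ((F.triv c).continuousLinearMapAt ℂ p) ∘L
      ContinuousLinearMap.adjoint ((F.triv c).symmL ℂ p) = ContinuousLinearMap.id ℂ _ := by
    rw [← ContinuousLinearMap.adjoint_comp, symm_comp_mapAt c p hc,
      ContinuousLinearMap.adjoint_id]
  have h5 : ContinuousLinearMap.adjoint ((E.triv b).continuousLinearMapAt ℂ p) ∘L
      ContinuousLinearMap.adjoint ((E.triv b).symmL ℂ p) = ContinuousLinearMap.id ℂ _ := by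
    rw [← ContinuousLinearMap.adjoint_comp, symm_comp_mapAt b p hb,
      ContinuousLinearMap.adjoint_id]
  rw [h1, h2, h3, ContinuousLinearMap.adjoint_comp, ContinuousLinearMap.adjoint_comp]
  ext1 w
  have h4' := fun w => congrArg (fun L => L w) h4
  have h5' := fun w => congrArg (fun L => L w) h5
  simp only [ContinuousLinearMap.comp_apply, ContinuousLinearMap.id_apply] at h4' h5'
  simp only [gram, ContinuousLinearMap.comp_apply, h4', h5']

theorem contMDiffOn_clmAdjoint {r s : ℕ} {S : Set X}
    {A : X → (ModelFiber r →L[ℂ] ModelFiber s)}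
    (hA : ContMDiffOn 𝓘(ℝ, ℂ) 𝓘(ℝ, ModelFiber r →L[ℂ] ModelFiber s) ∞ A S) :
    ContMDiffOn 𝓘(ℝ, ℂ) 𝓘(ℝ, ModelFiber s →L[ℂ] ModelFiber r) ∞
      (fun p => ContinuousLinearMap.adjoint (A p)) S := by
  have h : IsBoundedLinearMap ℝ (fun B : ModelFiber r →L[ℂ] ModelFiber s =>
      ContinuousLinearMap.adjoint B) :=
    { map_add := fun B C => map_add _ B C
      map_smul := fun k B => by
        ext1 w
        refine ext_inner_left ℂ fun t => ?_
        simp only [ContinuousLinearMap.adjoint_inner_right, smul_apply]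
        rw [RCLike.real_smul_eq_coe_smul (K := ℂ) k (B t), RCLike.real_smul_eq_coe_smul (K := ℂ) k
            (ContinuousLinearMap.adjoint B w), inner_smul_left, inner_smul_right,
            ContinuousLinearMap.adjoint_inner_right, RCLike.conj_ofReal]
      bound := ⟨1, one_pos, fun B => by rw [one_mul, LinearIsometryEquiv.norm_map]⟩ }
  exact h.contDiff.contMDiff.comp_contMDiffOn hA

theorem IsSmoothHomOn.adjoint {x : ∀ p, E.Fiber p →L[ℂ] F.Fiber p}
    (hx : IsSmoothHomOn E F U x) :
    IsSmoothHomOn F E U (fun p => ContinuousLinearMap.adjoint (x p)) := by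
  intro c b
  refine ContMDiffOn.congr ?_ (fun p hp => localRep_adjoint b c p hp.2.2 hp.2.1 (x p))
  refine contMDiffOn_clmComp ((gramInv_smooth b).mono fun p hp => hp.2.2)
    (contMDiffOn_clmComp (contMDiffOn_clmAdjoint ((hx b c).mono ?_))
      ((gram_smooth c).mono fun p hp => hp.2.1))
  rintro p ⟨h1, h2, h3⟩
  exact ⟨h1, h3, h2⟩

theorem contMDiffOn_clmExp {r : ℕ} {S : Set X}
    {A : X → (ModelFiber r →L[ℂ] ModelFiber r)}
    (hA : ContMDiffOn 𝓘(ℝ, ℂ) 𝓘(ℝ, ModelFiber r →L[ℂ] ModelFiber r) ∞ A S) :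
    ContMDiffOn 𝓘(ℝ, ℂ) 𝓘(ℝ, ModelFiber r →L[ℂ] ModelFiber r) ∞
      (fun p => NormedSpace.exp (A p)) S := by
  have h : ContDiff ℝ ∞ (fun B : ModelFiber r →L[ℂ] ModelFiber r => NormedSpace.exp B) :=
    contDiff_iff_contDiffAt.2 fun B => (NormedSpace.exp_analytic (𝕂 := ℝ) B).contDiffAt
  exact h.contMDiff.comp_contMDiffOn hA

theorem localRep_exp (b p : X) (hb : p ∈ (E.triv b).baseSet) (A : E.Fiber p →L[ℂ] E.Fiber p) :
    localRep E E b b p (NormedSpace.exp A) = NormedSpace.exp (localRep E E b b p A) := by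
  let f : (E.Fiber p →L[ℂ] E.Fiber p) →+* (ModelFiber E.rank →L[ℂ] ModelFiber E.rank) :=
    { toFun := localRep E E b b p
      map_one' := by
        change (E.triv b).continuousLinearMapAt ℂ p ∘L
          (ContinuousLinearMap.id ℂ _ ∘L (E.triv b).symmL ℂ p) = _
        rw [ContinuousLinearMap.id_comp, mapAt_comp_symm b p hb]; rfl
      map_mul' := fun B C => localRep_comp b b b p hb B C
      map_zero' := by ext w; simp [localRep, ContinuousLinearMap.inCoordinates]
      map_add' := localRep_add b b p }
  have hf : Continuous f := by
    change Continuous fun A : E.Fiber p →L[ℂ] E.Fiber p =>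
      (E.triv b).continuousLinearMapAt ℂ p ∘L (A ∘L (E.triv b).symmL ℂ p)
    fun_prop
  let _ : NormedAlgebra ℚ (E.Fiber p →L[ℂ] E.Fiber p) := NormedAlgebra.restrictScalars ℚ ℂ _
  exact NormedSpace.map_exp f hf A

theorem IsSmoothHomOn.exp {x : ∀ p, E.Fiber p →L[ℂ] E.Fiber p}
    (hx : IsSmoothHomOn E E U x) : IsSmoothHomOn E E U (fun p => NormedSpace.exp (x p)) := by
  intro b c
  have h1 := (hx b b).mono
    (show U ∩ ((E.triv b).baseSet ∩ (E.triv c).baseSet) ⊆ U ∩ _ from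
      fun p hp => ⟨hp.1, hp.2.1, hp.2.1⟩)
  refine (contMDiffOn_clmComp (IsSmoothHomOn.id (U := U) b c) (contMDiffOn_clmExp h1)).congr ?_
  intro p hp
  rw [← localRep_exp b p hp.2.1]
  exact localRep_comp b b c p hp.2.1 (ContinuousLinearMap.id ℂ _) _

end smooth

/-! ### Sections of `Hom(E, F)` and `Hom(E, F)`-valued two-forms -/

/-- `Ω⁰(X, Hom(E, F))`: smooth global sections of `Hom(E, F)`. -/
def HomSection (E F : HermitianBundle.{u, v} X) :
    Submodule ℂ (∀ p, E.Fiber p →L[ℂ] F.Fiber p) where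
  carrier := {x | IsSmoothHomOn E F univ x}
  add_mem' := fun hx hy => hx.add hy
  zero_mem' := IsSmoothHomOn.zero
  smul_mem' := fun _ _ hx => IsSmoothHomOn.smul contMDiffOn_const hx

instance (E F : HermitianBundle.{u, v} X) : Module ℝ (HomSection E F) := Module.complexToReal _

variable (X) in
/-- The real tangent space of the surface. -/
abbrev TangentPlane (p : X) : Type := TangentSpace 𝓘(ℝ, ℂ) p

/-- The frame `(∂/∂s, ∂/∂t)` at `p` of the holomorphic coordinate `s + i t` given by the preferred
chart around `c`. -/
def coordFrame (c p : X) : Fin 2 → TangentPlane X p :=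
  ![(mfderiv 𝓘(ℝ, ℂ) 𝓘(ℝ, ℂ) (chartAt ℂ c) p).inverse (1 : ℂ),
    (mfderiv 𝓘(ℝ, ℂ) 𝓘(ℝ, ℂ) (chartAt ℂ c) p).inverse Complex.I]

/-- `Ω²(X, Hom(E, F)) = Ω^{1,1}(X, Hom(E, F)) = Ω^{0,1}(X, Hom(E, F) ⊗ K)`: smooth `Hom(E, F)`-valued
two-forms on the Riemann surface `X` (every complex two-form on a Riemann surface is of type
`(1,1)`). Smoothness means that the coefficient of `ds ∧ dt` in every chart is smooth. -/
def HomTwoForm (E F : HermitianBundle.{u, v} X) :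
    Submodule ℂ (∀ p, TangentPlane X p [⋀^Fin 2]→ₗ[ℝ] (E.Fiber p →L[ℂ] F.Fiber p)) where
  carrier := {y | ∀ c : X, IsSmoothHomOn E F (chartAt ℂ c).source (fun p => y p (coordFrame c p))}
  add_mem' := fun hx hy c => (hx c).add (hy c)
  zero_mem' := fun _ => IsSmoothHomOn.zero
  smul_mem' := fun _ _ hx c => IsSmoothHomOn.smul contMDiffOn_const (hx c)

variable (X) in
/-- The area form of a Hermitian (Kähler) metric on the Riemann surface `X`: a smooth real two-form
that is positive for the complex orientation. -/
structure AreaForm where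
  form : ∀ p : X, TangentPlane X p [⋀^Fin 2]→ₗ[ℝ] ℝ
  smooth : ∀ c : X, ContMDiffOn 𝓘(ℝ, ℂ) 𝓘(ℝ, ℝ) ∞ (fun p => form p (coordFrame c p))
    (chartAt ℂ c).source
  pos : ∀ c : X, ∀ p ∈ (chartAt ℂ c).source, 0 < form p (coordFrame c p)

section operations

variable {E F G : HermitianBundle.{u, v} X}

/-- Composition of sections. -/
def HomSection.comp (y : HomSection F G) (x : HomSection E F) : HomSection E G :=
  ⟨fun p => y.1 p ∘L x.1 p, IsSmoothHomOn.comp y.2 x.2⟩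

/-- The Hermitian adjoint `x^*` of a section. -/
def HomSection.adj (x : HomSection E F) : HomSection F E :=
  ⟨fun p => ContinuousLinearMap.adjoint (x.1 p), IsSmoothHomOn.adjoint x.2⟩

/-- The product `x y` of a section `x` of `Hom(F, G)` and a two-form `y` with values in
`Hom(E, F)`. -/
def HomTwoForm.compLeft (x : HomSection F G) (y : HomTwoForm E F) : HomTwoForm E G :=
  ⟨fun p => LinearMap.compAlternatingMap
      { toFun := fun A : E.Fiber p →L[ℂ] F.Fiber p => x.1 p ∘L A
        map_add' := fun A B => ContinuousLinearMap.comp_add _ A B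
        map_smul' := fun k A => by ext w; simp } (y.1 p),
    fun c => IsSmoothHomOn.comp (IsSmoothHomOn.mono (subset_univ _) x.2) (y.2 c)⟩

/-- The product `y x` of a two-form `y` with values in `Hom(F, G)` and a section `x` of
`Hom(E, F)`. -/
def HomTwoForm.compRight (y : HomTwoForm F G) (x : HomSection E F) : HomTwoForm E G :=
  ⟨fun p => LinearMap.compAlternatingMap
      { toFun := fun A : F.Fiber p →L[ℂ] G.Fiber p => A ∘L x.1 p
        map_add' := fun A B => ContinuousLinearMap.add_comp A B _
        map_smul' := fun k A => by ext w; simp } (y.1 p),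
    fun c => IsSmoothHomOn.comp (y.2 c) (IsSmoothHomOn.mono (subset_univ _) x.2)⟩

/-- The trace of a section of `End(E)`. -/
def HomSection.trace (x : HomSection E E) (p : X) : ℂ :=
  LinearMap.trace ℂ (E.Fiber p) (x.1 p : E.Fiber p →ₗ[ℂ] E.Fiber p)

/-- The trace of an `End(E)`-valued two-form, a complex-valued two-form. -/
def HomTwoForm.trace (y : HomTwoForm E E) (p : X) : TangentPlane X p [⋀^Fin 2]→ₗ[ℝ] ℂ :=
  LinearMap.compAlternatingMap
    { toFun := fun A : E.Fiber p →L[ℂ] E.Fiber p =>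
        LinearMap.trace ℂ (E.Fiber p) (A : E.Fiber p →ₗ[ℂ] E.Fiber p)
      map_add' := fun A B => by simp
      map_smul' := fun k A => by
        have : ((k • A : E.Fiber p →L[ℂ] E.Fiber p) : E.Fiber p →ₗ[ℂ] E.Fiber p) =
          (k : ℂ) • (A : E.Fiber p →ₗ[ℂ] E.Fiber p) := by ext w; simp
        rw [this, map_smul]; simp } (y.1 p)

theorem alternating_plane {N : Type*} [AddCommGroup N] [Module ℝ N]
    (γ : ℂ [⋀^Fin 2]→ₗ[ℝ] N) (a : Fin 2 → ℂ) :
    γ a = ((a 0).re * (a 1).im - (a 0).im * (a 1).re) • γ ![1, Complex.I] := by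
  have hadd : ∀ x y z : ℂ, γ ![x + y, z] = γ ![x, z] + γ ![y, z] :=
    fun x y z => γ.map_vecCons_add ![z] x y
  have hsm : ∀ (k : ℝ) (x z : ℂ), γ ![k • x, z] = k • γ ![x, z] :=
    fun k x z => γ.map_vecCons_smul ![z] k x
  have hsw : ∀ x z : ℂ, γ ![x, z] = - γ ![z, x] := by
    intro x z
    rw [← γ.map_swap ![z, x] (show (0 : Fin 2) ≠ 1 by decide)]
    congr 1
    ext i
    fin_cases i <;> rfl
  have hself : ∀ x : ℂ, γ ![x, x] = 0 := fun x =>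
    γ.map_eq_zero_of_eq ![x, x] (i := 0) (j := 1) rfl (by decide)
  have hz : ∀ z : ℂ, z = z.re • (1 : ℂ) + z.im • Complex.I := fun z => by
    simp [Complex.re_add_im]
  have ha : a = ![a 0, a 1] := by ext i; fin_cases i <;> rfl
  have h1 : ∀ z : ℂ, γ ![(1 : ℂ), z] = z.im • γ ![1, Complex.I] := by
    intro z
    rw [hsw]
    conv_lhs => rw [hz z]
    rw [hadd, hsm, hsm, hself, hsw Complex.I]
    simp
  have hI : ∀ z : ℂ, γ ![Complex.I, z] = - (z.re • γ ![1, Complex.I]) := by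
    intro z
    rw [hsw]
    conv_lhs => rw [hz z]
    rw [hadd, hsm, hsm, hself]
    simp
  conv_lhs => rw [ha, hz (a 0)]
  rw [hadd, hsm, hsm, h1, hI]
  module

theorem alternating_ratio {N : Type*} [AddCommGroup N] [Module ℝ N]
    (β : ℂ [⋀^Fin 2]→ₗ[ℝ] ℝ) (α : ℂ [⋀^Fin 2]→ₗ[ℝ] N) (u w : Fin 2 → ℂ) :
    β u • α w = β w • α u := by
  have hβ := fun a => alternating_plane (γ := β) a
  have hα := fun a => alternating_plane (γ := α) a
  rw [hα w, hα u, hβ w, hβ u]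
  module

/-- The function `⋆y` with values in `Hom(E, F)` such that `y = (⋆y) σ`, for the area form `σ`. -/
def AreaForm.star (σ : AreaForm X) (y : HomTwoForm E F) : HomSection E F :=
  ⟨fun p => (((σ.form p (coordFrame p p))⁻¹ : ℝ) : ℂ) • y.1 p (coordFrame p p), by
    intro b c
    rintro p ⟨-, hp⟩
    have hsm : IsSmoothHomOn E F (chartAt ℂ p).source
        (fun q => (((σ.form q (coordFrame p q))⁻¹ : ℝ) : ℂ) • y.1 q (coordFrame p q)) := by
      refine IsSmoothHomOn.smul ?_ (y.2 p)
      intro q hq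
      have h1 : ContDiffAt ℝ ∞ (fun t : ℝ => ((t⁻¹ : ℝ) : ℂ)) (σ.form q (coordFrame p q)) :=
        Complex.ofRealCLM.contDiff.contDiffAt.comp _ (contDiffAt_inv ℝ (σ.pos p q hq).ne')
      exact h1.contMDiffAt.comp_contMDiffWithinAt q (σ.smooth p q hq)
    have heq : ∀ q ∈ (chartAt ℂ p).source,
        (((σ.form q (coordFrame q q))⁻¹ : ℝ) : ℂ) • y.1 q (coordFrame q q) =
          (((σ.form q (coordFrame p q))⁻¹ : ℝ) : ℂ) • y.1 q (coordFrame p q) := by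
      intro q hq
      have h1 := (σ.pos p q hq).ne'
      have h2 := (σ.pos q q (mem_chart_source ℂ q)).ne'
      have h3 := alternating_ratio (σ.form q) (y.1 q) (coordFrame q q) (coordFrame p q)
      rw [Complex.coe_smul, Complex.coe_smul, inv_smul_eq_iff₀ h2, smul_comm,
        eq_inv_smul_iff₀ h1]
      exact h3.symm
    have hpsrc : (chartAt ℂ p).source ∈ nhds p :=
      (chartAt ℂ p).open_source.mem_nhds (mem_chart_source ℂ p)
    refine (contMDiffWithinAt_inter hpsrc).1 ?_
    have := ((hsm b c).congr (f₁ := fun q => localRep E F b c q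
      ((((σ.form q (coordFrame q q))⁻¹ : ℝ) : ℂ) • y.1 q (coordFrame q q)))
      (fun q hq => by rw [heq q hq.1])) p ⟨mem_chart_source ℂ p, hp⟩
    exact this.mono (fun q hq => ⟨hq.2, hq.1.2⟩)⟩

/-- The product `f σ` of a complex function and the area form. -/
def AreaForm.smulForm (σ : AreaForm X) (f : X → ℂ) (p : X) : TangentPlane X p [⋀^Fin 2]→ₗ[ℝ] ℂ :=
  LinearMap.compAlternatingMap (LinearMap.toSpanSingleton ℝ ℂ (f p)) (σ.form p)

end operations

/-! ### Integration -/

/-- A complex curve is a smooth real surface. -/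
theorem isManifold_real (X : Type u) [TopologicalSpace X] [ChartedSpace ℂ X]
    [IsManifold 𝓘(ℂ) ω X] : IsManifold 𝓘(ℝ, ℂ) ∞ X := by
  refine isManifold_of_contDiffOn _ _ _ fun e e' he he' => ?_
  have h := (contDiffGroupoid ω 𝓘(ℂ)).compatible he he'
  rw [contDiffGroupoid, mem_groupoid_of_pregroupoid] at h
  exact (h.1.restrict_scalars ℝ).of_le le_top

section integration

variable (X) [CompactSpace X] [T2Space X] [IsManifold 𝓘(ℂ) ω X]

theorem exists_partition : ∃ f : SmoothPartitionOfUnity X 𝓘(ℝ, ℂ) X univ,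
    f.IsSubordinate (fun c => (chartAt ℂ c).source) :=
  have := isManifold_real X
  SmoothPartitionOfUnity.exists_isSubordinate_chartAt_source 𝓘(ℝ, ℂ) X

/-- A smooth partition of unity subordinate to the preferred charts. -/
def partition : SmoothPartitionOfUnity X 𝓘(ℝ, ℂ) X univ := (exists_partition X).choose

variable {X}

/-- The integral `∫_X α` of a complex-valued two-form over the compact Riemann surface `X` with its
complex orientation: `∑_c ∫ ρ_c α` for a partition of unity `ρ` subordinate to the charts, each
summand being computed in the holomorphic coordinate `z = s + i t` of the chart around `c` as
the Lebesgue integral of the coefficient of `ds ∧ dt`. -/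
def integral (α : ∀ p, TangentPlane X p [⋀^Fin 2]→ₗ[ℝ] ℂ) : ℂ :=
  ∑ᶠ c : X, ∫ z in (chartAt ℂ c).target,
    ((partition X c ((chartAt ℂ c).symm z) : ℝ) : ℂ) *
      α ((chartAt ℂ c).symm z) (coordFrame c ((chartAt ℂ c).symm z))

end integration

/-! ### The gauge group and its Lie algebra -/

/-- The group `Aut(E)` of smooth unitary automorphisms of `E`. -/
def gaugeSubgroup (E : HermitianBundle.{u, v} X) :
    Subgroup (∀ p, unitary (E.Fiber p →L[ℂ] E.Fiber p)) where
  carrier := {g | IsSmoothHomOn E E univ (fun p => (g p : E.Fiber p →L[ℂ] E.Fiber p))}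
  mul_mem' := fun hg hh => IsSmoothHomOn.comp hg hh
  one_mem' := IsSmoothHomOn.id
  inv_mem' := fun hg => IsSmoothHomOn.adjoint hg

/-- The Lie algebra of `Aut(E)`: smooth skew-adjoint endomorphisms of `E`. -/
def gaugeLie (E : HermitianBundle.{u, v} X) : Submodule ℝ (HomSection E E) where
  carrier := {θ | ∀ p, star (θ.1 p) = -θ.1 p}
  add_mem' := fun {a b} ha hb p => by
    change star (a.1 p + b.1 p) = -(a.1 p + b.1 p)
    rw [star_add, ha p, hb p]; abel
  zero_mem' := fun p => by
    change star (0 : E.Fiber p →L[ℂ] E.Fiber p) = -0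
    simp
  smul_mem' := fun k a ha p => by
    change star ((k : ℂ) • a.1 p) = -((k : ℂ) • a.1 p)
    rw [star_smul, ha p]; simp

/-- A gauge transformation as an endomorphism of the bundle. -/
def gaugeHom {E : HermitianBundle.{u, v} X} (g : gaugeSubgroup E) : HomSection E E :=
  ⟨fun p => (g.1 p : E.Fiber p →L[ℂ] E.Fiber p), g.2⟩

/-- The exponential map of the gauge group. -/
def gaugeExp {E : HermitianBundle.{u, v} X} (θ : gaugeLie E) : gaugeSubgroup E :=
  ⟨fun p => ⟨NormedSpace.exp (θ.1.1 p), by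
      let _ : NormedAlgebra ℚ (E.Fiber p →L[ℂ] E.Fiber p) := NormedAlgebra.restrictScalars ℚ ℂ _
      exact NormedSpace.exp_mem_unitary_of_mem_skewAdjoint (skewAdjoint.mem_iff.2 (θ.2 p))⟩,
    IsSmoothHomOn.exp θ.1.2⟩

/-- The adjoint action `θ ↦ g θ g⁻¹`. -/
def gaugeAd {E : HermitianBundle.{u, v} X} (g : gaugeSubgroup E) (θ : gaugeLie E) : gaugeLie E :=
  ⟨HomSection.comp (HomSection.comp (gaugeHom g) θ.1) (gaugeHom g⁻¹), fun p => by
    change star ((g.1 p : E.Fiber p →L[ℂ] E.Fiber p) * θ.1.1 p * star (g.1 p).1) =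
      -((g.1 p : E.Fiber p →L[ℂ] E.Fiber p) * θ.1.1 p * star (g.1 p).1)
    rw [star_mul, star_mul, star_star, θ.2 p]
    simp [mul_assoc]⟩

/-! ### Edge representations of the double quiver -/

section quiver

variable {V : Type*} [Quiver.{w + 1} V]

/-- The space of edge representations of the double of the quiver `V` in the family of bundles `E`:
a smooth section `x_a` of `Hom(E_i, E_j)` for every edge `a : i ⟶ j`, and a `Hom(E_j, E_i)`-valued
`(1,1)`-form `y_a` for the reversed edge. By the pairing `(x, y) ↦ ∫ tr (x y)` this is the (smooth)
cotangent space of `⨁_a Ω⁰(X, Hom(E_i, E_j))`; the form `y_a ∈ Ω^{0,1}(X, Hom(E_j, E_i) ⊗ K)` is a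
Dolbeault representative of the class in `H¹(X, Hom(E_j, E_i) ⊗ K)`. -/
@[ext]
structure EdgeRep (E : V → HermitianBundle.{u, v} X) where
  x : ∀ i j : V, (i ⟶ j) → HomSection (E i) (E j)
  y : ∀ i j : V, (i ⟶ j) → HomTwoForm (E j) (E i)

variable (E : V → HermitianBundle.{u, v} X)

/-- The vector space structure is the componentwise one. -/
def EdgeRep.equiv : EdgeRep E ≃ ((∀ i j : V, (i ⟶ j) → HomSection (E i) (E j)) ×
    (∀ i j : V, (i ⟶ j) → HomTwoForm (E j) (E i))) where
  toFun z := (z.x, z.y)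
  invFun z := ⟨z.1, z.2⟩
  left_inv _ := rfl
  right_inv _ := rfl

instance : AddCommGroup (EdgeRep E) := (EdgeRep.equiv E).addCommGroup

instance : Module ℂ (EdgeRep E) := (EdgeRep.equiv E).module ℂ

/-- The group `𝒢 = ∏_i Aut(E_i)`. -/
def GaugeGroup : Type _ := ∀ i : V, gaugeSubgroup (E i)

instance : Group (GaugeGroup E) := inferInstanceAs (Group (∀ i : V, gaugeSubgroup (E i)))

/-- The Lie algebra `𝔤 = ⨁_i Lie(Aut(E_i))`. -/
def GaugeAlgebra : Type _ := ∀ i : V, gaugeLie (E i)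

instance : AddCommGroup (GaugeAlgebra E) :=
  inferInstanceAs (AddCommGroup (∀ i : V, gaugeLie (E i)))

instance : Module ℝ (GaugeAlgebra E) := inferInstanceAs (Module ℝ (∀ i : V, gaugeLie (E i)))

variable {E} in
/-- The exponential map `𝔤 → 𝒢`. -/
def GaugeAlgebra.exp (θ : GaugeAlgebra E) : GaugeGroup E := fun i => gaugeExp (θ i)

variable {E} in
/-- The adjoint action of `𝒢` on `𝔤`. -/
def GaugeGroup.ad (g : GaugeGroup E) (θ : GaugeAlgebra E) : GaugeAlgebra E :=
  fun i => gaugeAd (g i) (θ i)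

variable {E}

/-- The gauge action `g · (x, y) = (g_{h(a)} x_a g_{t(a)}⁻¹, g_{t(a)} y_a g_{h(a)}⁻¹)`. -/
instance : MulAction (GaugeGroup E) (EdgeRep E) where
  smul g z :=
    ⟨fun i j a => HomSection.comp (HomSection.comp (gaugeHom (g j)) (z.x i j a))
        (gaugeHom (g i)⁻¹),
      fun i j a => HomTwoForm.compRight (HomTwoForm.compLeft (gaugeHom (g i)) (z.y i j a))
        (gaugeHom (g j)⁻¹)⟩
  one_smul z := by
    refine EdgeRep.ext ?_ ?_
    · funext i j a
      refine Subtype.ext (funext fun p => ?_)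
      change (1 : (E j).Fiber p →L[ℂ] (E j).Fiber p) ∘L (z.x i j a).1 p ∘L
        ((1 : gaugeSubgroup (E i))⁻¹.1 p).1 = _
      rw [inv_one]
      rfl
    · funext i j a
      refine Subtype.ext (funext fun p => AlternatingMap.ext fun t => ?_)
      change (1 : (E i).Fiber p →L[ℂ] (E i).Fiber p) ∘L (z.y i j a).1 p t ∘L
        ((1 : gaugeSubgroup (E j))⁻¹.1 p).1 = _
      rw [inv_one]
      rfl
  mul_smul g h z := by
    refine EdgeRep.ext ?_ ?_
    · funext i j a
      refine Subtype.ext (funext fun p => ?_)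
      change ((g j).1 p).1 ∘L ((h j).1 p).1 ∘L (z.x i j a).1 p ∘L ((g i * h i)⁻¹.1 p).1 = _
      rw [mul_inv_rev]
      rfl
    · funext i j a
      refine Subtype.ext (funext fun p => AlternatingMap.ext fun t => ?_)
      change ((g i).1 p).1 ∘L ((h i).1 p).1 ∘L (z.y i j a).1 p t ∘L ((g j * h j)⁻¹.1 p).1 = _
      rw [mul_inv_rev]
      rfl

/-- The infinitesimal action
`θ · (x, y) = (θ_{h(a)} x_a - x_a θ_{t(a)}, θ_{t(a)} y_a - y_a θ_{h(a)})`. -/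
def infAction (θ : GaugeAlgebra E) (z : EdgeRep E) : EdgeRep E :=
  ⟨fun i j a => HomSection.comp (θ j).1 (z.x i j a) - HomSection.comp (z.x i j a) (θ i).1,
    fun i j a => HomTwoForm.compLeft (θ i).1 (z.y i j a) -
      HomTwoForm.compRight (z.y i j a) (θ j).1⟩

variable [Fintype V] [∀ i j : V, Fintype (i ⟶ j)]

section forms

variable [CompactSpace X] [T2Space X] [IsManifold 𝓘(ℂ) ω X]

/-- The real symplectic form: twice the imaginary part of the `L²` Hermitian inner product
`∑_a ∫_X tr (x_a x'_a^* + y'_a^* y_a)`. The (conjugate-linear) adjoint of a two-form is taken with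
respect to the metrics of the bundles and of `X`; as the area form `σ` has length one, the
endomorphism `y'^* y` is `(⋆y')^* (⋆y)`. -/
def omegaR (σ : AreaForm X) (z z' : EdgeRep E) : ℝ :=
  2 * (∑ i : V, ∑ j : V, ∑ a : i ⟶ j, integral (σ.smulForm (HomSection.trace
    (HomSection.comp (z.x i j a) (HomSection.adj (z'.x i j a)) +
      HomSection.comp (HomSection.adj (σ.star (z'.y i j a))) (σ.star (z.y i j a)))))).im

/-- The complex symplectic form `∑_a ∫_X tr (x_a y'_a - x'_a y_a)`. -/
def omegaC (z z' : EdgeRep E) : ℂ :=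
  ∑ i : V, ∑ j : V, ∑ a : i ⟶ j, integral (HomTwoForm.trace
    (HomTwoForm.compLeft (z.x i j a) (z'.y i j a) -
      HomTwoForm.compLeft (z'.x i j a) (z.y i j a)))

/-- The pairing of a family of (self-adjoint) endomorphisms with the Lie algebra `𝔤`: the value of
`(1/√-1) ∑_i ∫_X tr (θ_i m_i) σ`, which is real for `θ_i` skew-adjoint and `m_i` self-adjoint. -/
def pairR (σ : AreaForm X) (m : ∀ i, HomSection (E i) (E i)) (θ : GaugeAlgebra E) : ℝ :=
  (∑ i : V, integral (σ.smulForm (HomSection.trace (HomSection.comp (θ i).1 (m i))))).im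

/-- The pairing `∑_i ∫_X tr (θ_i m_i)` of a family of `End(E_i)`-valued two-forms with the Lie
algebra `𝔤`. -/
def pairC (m : ∀ i, HomTwoForm (E i) (E i)) (θ : GaugeAlgebra E) : ℂ :=
  ∑ i : V, integral (HomTwoForm.trace (HomTwoForm.compLeft (θ i).1 (m i)))

end forms

/-- The real moment map: its component at the vertex `i` is
`∑_{h(a) = i} (x_a x_a^* - y_a^* y_a) - ∑_{t(a) = i} (x_a^* x_a - y_a y_a^*)`. -/
def muR (σ : AreaForm X) (z : EdgeRep E) (i : V) : HomSection (E i) (E i) :=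
  (∑ j : V, ∑ a : j ⟶ i,
    (HomSection.comp (z.x j i a) (HomSection.adj (z.x j i a)) -
      HomSection.comp (HomSection.adj (σ.star (z.y j i a))) (σ.star (z.y j i a)))) -
  ∑ j : V, ∑ a : i ⟶ j,
    (HomSection.comp (HomSection.adj (z.x i j a)) (z.x i j a) -
      HomSection.comp (σ.star (z.y i j a)) (HomSection.adj (σ.star (z.y i j a))))

/-- The complex moment map: its component at the vertex `i` is
`∑_{h(a) = i} x_a y_a - ∑_{t(a) = i} y_a x_a`. -/
def muC (z : EdgeRep E) (i : V) : HomTwoForm (E i) (E i) :=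
  (∑ j : V, ∑ a : j ⟶ i, HomTwoForm.compLeft (z.x j i a) (z.y j i a)) -
  ∑ j : V, ∑ a : i ⟶ j, HomTwoForm.compRight (z.y i j a) (z.x i j a)

end quiver

/-! ### Hamiltonian actions -/

/-- A linear action of a group `G` with Lie algebra `𝔤` on a `𝕜`-vector space `W` is Hamiltonian for
the constant (hence closed) symplectic form `Ω`, with moment map `μ : W → 𝔤^*`. Here `ξ θ` is the
vector field generated by `θ ∈ 𝔤` and `Ad` the adjoint action. The form is only required to be
weakly non-degenerate, as `W` may have infinite dimension, and the differential
`d⟨μ, θ⟩_z (w) = Ω (ξ_θ (z), w)` is computed as the derivative at `z` in every direction `w`. -/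
structure IsHamiltonianAction (𝕜 : Type*) [RCLike 𝕜] {G 𝔤 W : Type*} [Group G] [AddCommGroup 𝔤]
    [Module ℝ 𝔤] [AddCommGroup W] [Module 𝕜 W] [MulAction G W]
    (Ad : G → 𝔤 → 𝔤) (ξ : 𝔤 → W → W) (Ω : W → W → 𝕜) (μ : W → 𝔤 → 𝕜) : Prop where
  form_add : ∀ z z' w, Ω (z + z') w = Ω z w + Ω z' w
  form_smul : ∀ (k : 𝕜) (z w), Ω (k • z) w = k * Ω z w
  form_skew : ∀ z w, Ω z w = - Ω w z
  form_nondegenerate : ∀ z, (∀ w, Ω z w = 0) → z = 0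
  form_invariant : ∀ (g : G) (z w), Ω (g • z) (g • w) = Ω z w
  moment_add : ∀ z θ η, μ z (θ + η) = μ z θ + μ z η
  moment_smul : ∀ (z) (k : ℝ) (θ), μ z (k • θ) = (k : 𝕜) * μ z θ
  moment_deriv : ∀ θ z w, HasLineDerivAt 𝕜 (fun z => μ z θ) (Ω (ξ θ z) w) z w
  moment_equivariant : ∀ (g : G) (z θ), μ (g • z) (Ad g θ) = μ z θ

end QuiverBundle

/-!
Both moment maps are instances of one fact: a linear action preserving a constant symplectic form
`Ω` has the quadratic moment map `⟨μ, θ⟩ (z) = ½ Ω (ξ_θ z, z)`. On the space of edge representations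
let `H` be the `L²` Hermitian form `∑_a ∫ tr (x_a x'_a^* + (⋆y_a) (⋆y'_a)^*) σ` and let `J (x, y) =
((⋆y)^*, -x^* σ)`, a conjugate-linear map with `J² = -1`. The gauge group acts unitarily for `H` and
commutes with `J`, and `ω_ℝ = 2 Im H`, while `ω_ℂ (z, w) = H (z, J w)`. Both forms are
non-degenerate because `H` is definite, and the invariance of the trace under cyclic permutations
turns `½ Ω (ξ_θ z, z)` into the pairings of `θ` with `μ_ℝ` and `μ_ℂ`.
-/

namespace QuiverBundle

universe u v w

section symplectic

variable {G 𝔤 W : Type*} [Group G] [AddCommGroup 𝔤] [Module ℝ 𝔤] [AddCommGroup W] [MulAction G W]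

theorem hasLineDerivAt_apply_self {𝕜 : Type*} [NontriviallyNormedField 𝕜] [Module 𝕜 W]
    (B : W →ₗ[𝕜] W →ₗ[𝕜] 𝕜) (z w : W) :
    HasLineDerivAt 𝕜 (fun z => B z z) (B w z + B z w) z w := by
  have h : HasDerivAt (fun t : 𝕜 => B z z + t * (B w z + B z w) + t ^ 2 * B w w)
      (B w z + B z w) 0 := by
    refine ((((hasDerivAt_id (0 : 𝕜)).mul_const (B w z + B z w)).const_add (B z z)).add
      ((hasDerivAt_pow 2 (0 : 𝕜)).mul_const (B w w))).congr_deriv ?_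
    ring
  refine h.congr_of_eventuallyEq (.of_forall fun t => ?_)
  simp only [map_add, map_smul, LinearMap.add_apply, LinearMap.smul_apply, smul_eq_mul]
  ring

theorem IsHamiltonianAction.of_two_mul_moment_eq {𝕜 : Type*} [RCLike 𝕜] [Module 𝕜 W]
    {Ad : G → 𝔤 → 𝔤} {ξ : 𝔤 → W →ₗ[𝕜] W} {Ω : W →ₗ[𝕜] W →ₗ[𝕜] 𝕜} {μ : W → 𝔤 → 𝕜}
    (alternating : Ω.IsAlt) (separating : Ω.SeparatingLeft)
    (invariant : ∀ (g : G) z w, Ω (g • z) (g • w) = Ω z w)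
    (ξ_add : ∀ θ η, ξ (θ + η) = ξ θ + ξ η) (ξ_smul : ∀ (k : ℝ) θ, ξ (k • θ) = (k : 𝕜) • ξ θ)
    (skew : ∀ θ z w, Ω (ξ θ z) w = -Ω z (ξ θ w))
    (equivariant : ∀ (g : G) θ z, ξ (Ad g θ) (g • z) = g • ξ θ z)
    (two_mul_moment : ∀ z θ, 2 * μ z θ = Ω (ξ θ z) z) :
    IsHamiltonianAction 𝕜 Ad (fun θ z => ξ θ z) (fun z w => Ω z w) μ := by
  have moment_eq : ∀ z θ, μ z θ = 2⁻¹ * Ω (ξ θ z) z := fun z θ => by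
    rw [← two_mul_moment, inv_mul_cancel_left₀ two_ne_zero]
  exact {
    form_add := fun z z' w => by rw [map_add, LinearMap.add_apply]
    form_smul := fun k z w => by rw [map_smul, LinearMap.smul_apply, smul_eq_mul]
    form_skew := fun z w => (alternating.neg w z).symm
    form_nondegenerate := separating
    form_invariant := invariant
    moment_add := fun z θ η => by
      simp only [moment_eq, ξ_add, LinearMap.add_apply, map_add, mul_add]
    moment_smul := fun z k θ => by
      simp only [moment_eq, ξ_smul, LinearMap.smul_apply, map_smul, smul_eq_mul, mul_left_comm]
    moment_deriv := fun θ z w => by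
      have symmetric : Ω (ξ θ w) z = Ω (ξ θ z) w := by rw [skew, alternating.neg]
      have derivative : 2⁻¹ * Ω (ξ θ w) z + 2⁻¹ * Ω (ξ θ z) w = Ω (ξ θ z) w := by
        rw [symmetric]
        ring
      have h := hasLineDerivAt_apply_self ((2⁻¹ : 𝕜) • Ω ∘ₗ ξ θ) z w
      simpa only [moment_eq, LinearMap.smul_apply, LinearMap.comp_apply, smul_eq_mul,
        derivative] using h
    moment_equivariant := fun g z θ => by simp only [moment_eq, equivariant, invariant] }

variable [Module ℂ W]

/-- The group `G` and its Lie algebra `𝔤`, acting through `ξ`, preserve the definite Hermitian form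
`H` on `W`, which is linear in the first and conjugate-linear in the second variable. -/
structure IsUnitaryAction (Ad : G → 𝔤 → 𝔤) (ξ : 𝔤 →ₗ[ℝ] Module.End ℂ W)
    (H : W →ₗ[ℂ] W →ₗ⋆[ℂ] ℂ) : Prop where
  conj_symm : ∀ z w, starRingEnd ℂ (H z w) = H w z
  definite : ∀ z, H z z = 0 → z = 0
  invariant : ∀ (g : G) z w, H (g • z) (g • w) = H z w
  skew : ∀ θ z w, H (ξ θ z) w = -H z (ξ θ w)
  equivariant : ∀ (g : G) θ z, ξ (Ad g θ) (g • z) = g • ξ θ z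

/-- The conjugate-linear map `J` is a quaternionic structure on `W` that commutes with the actions
of `G` and `𝔤` and for which `H z (J w)` is alternating. -/
structure IsQuaternionicStructure (G : Type*) [Group G] [MulAction G W]
    (ξ : 𝔤 →ₗ[ℝ] Module.End ℂ W) (H : W →ₗ[ℂ] W →ₗ⋆[ℂ] ℂ) (J : W →ₗ⋆[ℂ] W) : Prop where
  apply_apply : ∀ z, J (J z) = -z
  alternating : ∀ z, H z (J z) = 0
  map_group_smul : ∀ (g : G) z, J (g • z) = g • J z
  map_lie : ∀ θ z, J (ξ θ z) = ξ θ (J z)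

namespace IsUnitaryAction

variable {Ad : G → 𝔤 → 𝔤} {ξ : 𝔤 →ₗ[ℝ] Module.End ℂ W} {H : W →ₗ[ℂ] W →ₗ⋆[ℂ] ℂ}

theorem isHamiltonianAction_two_mul_im (hH : IsUnitaryAction Ad ξ H) :
    IsHamiltonianAction ℝ Ad (fun θ z => ξ θ z) (fun z w => 2 * (H z w).im)
      (fun z θ => (H (ξ θ z) z).im) := by
  let Ω : W →ₗ[ℝ] W →ₗ[ℝ] ℝ := LinearMap.mk₂ ℝ (fun z w => 2 * (H z w).im)
    (fun z z' w => by rw [map_add, LinearMap.add_apply, Complex.add_im, mul_add])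
    (fun k z w => by
      rw [← Complex.coe_smul, map_smul, LinearMap.smul_apply, smul_eq_mul, Complex.im_ofReal_mul,
        smul_eq_mul, mul_left_comm])
    (fun z w w' => by rw [map_add, Complex.add_im, mul_add])
    (fun k z w => by
      rw [← Complex.coe_smul, map_smulₛₗ, Complex.conj_ofReal, smul_eq_mul, Complex.im_ofReal_mul,
        smul_eq_mul, mul_left_comm])
  have im_self (z) : (H z z).im = 0 := Complex.conj_eq_iff_im.1 (hH.conj_symm z z)
  refine IsHamiltonianAction.of_two_mul_moment_eq (Ω := Ω)
    (ξ := fun θ => (ξ θ).restrictScalars ℝ) (fun z => ?_) (fun z hz => hH.definite z ?_)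
    (fun g z w => ?_) (fun θ η => ?_) (fun k θ => ?_) (fun θ z w => ?_) hH.equivariant
    (fun _ _ => rfl)
  · exact (congrArg (2 * ·) (im_self z)).trans (mul_zero 2)
  · have h : 2 * (H z (Complex.I • z)).im = 0 := hz _
    rw [map_smulₛₗ, Complex.conj_I, smul_eq_mul, neg_mul, Complex.neg_im, Complex.I_mul_im] at h
    exact Complex.ext (by simpa using h) (im_self z)
  · exact congrArg (fun c : ℂ => 2 * c.im) (hH.invariant g z w)
  · rw [map_add]; rfl
  · rw [map_smul]; rfl
  · exact (congrArg (fun c : ℂ => 2 * c.im) (hH.skew θ z w)).trans (mul_neg 2 _)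

theorem isHamiltonianAction_quaternionic (hH : IsUnitaryAction Ad ξ H) {J : W →ₗ⋆[ℂ] W}
    (hJ : IsQuaternionicStructure G ξ H J) {μ : W → 𝔤 → ℂ}
    (two_mul_moment : ∀ z θ, 2 * μ z θ = H (ξ θ z) (J z)) :
    IsHamiltonianAction ℂ Ad (fun θ z => ξ θ z) (fun z w => H z (J w)) μ := by
  let Ω : W →ₗ[ℂ] W →ₗ[ℂ] ℂ := H.compl₂ J
  refine IsHamiltonianAction.of_two_mul_moment_eq (Ω := Ω) (ξ := fun θ => ξ θ) hJ.alternating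
    (fun z hz => hH.definite z ?_) (fun g z w => ?_) (map_add ξ) (map_smul ξ) (fun θ z w => ?_)
    hH.equivariant two_mul_moment
  · have h : H z (J (J z)) = 0 := hz _
    rwa [hJ.apply_apply, map_neg, neg_eq_zero] at h
  · change H (g • z) (J (g • w)) = H z (J w)
    rw [hJ.map_group_smul, hH.invariant]
  · change H (ξ θ z) (J w) = -H z (J (ξ θ w))
    rw [hJ.map_lie, hH.skew]

end IsUnitaryAction

end symplectic

section integration

open MeasureTheory

variable {X : Type u} [TopologicalSpace X] [ChartedSpace ℂ X]

/-- Continuity of a two-form: its coefficient of `ds ∧ dt` in every chart is continuous. It makes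
the integral additive. -/
def IsContinuousForm (α : ∀ p, TangentPlane X p [⋀^Fin 2]→ₗ[ℝ] ℂ) : Prop :=
  ∀ c : X, ContinuousOn (fun p => α p (coordFrame c p)) (chartAt ℂ c).source

theorem AreaForm.isContinuousForm_smulForm (σ : AreaForm X) {f : X → ℂ} (hf : Continuous f) :
    IsContinuousForm (σ.smulForm f) :=
  fun c => (σ.smooth c).continuousOn.smul hf.continuousOn

theorem AreaForm.smulForm_add (σ : AreaForm X) (f g : X → ℂ) :
    σ.smulForm (f + g) = σ.smulForm f + σ.smulForm g :=
  funext fun p => AlternatingMap.ext fun w => smul_add (σ.form p w) (f p) (g p)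

theorem AreaForm.smulForm_smul (σ : AreaForm X) (k : ℂ) (f : X → ℂ) :
    σ.smulForm (k • f) = k • σ.smulForm f :=
  funext fun p => AlternatingMap.ext fun w => smul_comm (σ.form p w) k (f p)

variable [CompactSpace X] [T2Space X] [IsManifold 𝓘(ℂ) ω X]

theorem tsupport_partition_subset (c : X) : tsupport (partition X c) ⊆ (chartAt ℂ c).source :=
  (exists_partition X).choose_spec c

theorem continuousOn_partition_symm (c : X) :
    ContinuousOn (fun z => partition X c ((chartAt ℂ c).symm z)) (chartAt ℂ c).target :=
  (partition X c).contMDiff.continuous.comp_continuousOn (chartAt ℂ c).continuousOn_symm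

variable (X) in
theorem finite_support_partition_nonempty :
    {c : X | (Function.support (partition X c)).Nonempty}.Finite :=
  (partition X).locallyFinite.finite_nonempty_of_compact

variable (X) in
/-- The finite set of those points whose preferred charts carry the partition of unity; it turns
`integral` into a finite sum. -/
def partitionCharts : Finset X := (finite_support_partition_nonempty X).toFinset

theorem mem_partitionCharts {c p : X} (hp : partition X c p ≠ 0) : c ∈ partitionCharts X :=
  (finite_support_partition_nonempty X).mem_toFinset.2 ⟨p, hp⟩

/-- The summand of `integral` that belongs to the chart around `c`, as a function of the
coordinate. -/
def chartIntegrand (c : X) (α : ∀ p, TangentPlane X p [⋀^Fin 2]→ₗ[ℝ] ℂ) (z : ℂ) : ℂ :=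
  ((partition X c ((chartAt ℂ c).symm z) : ℝ) : ℂ) *
    α ((chartAt ℂ c).symm z) (coordFrame c ((chartAt ℂ c).symm z))

theorem integral_eq_sum (α : ∀ p, TangentPlane X p [⋀^Fin 2]→ₗ[ℝ] ℂ) :
    integral α = ∑ c ∈ partitionCharts X, ∫ z in (chartAt ℂ c).target, chartIntegrand c α z := by
  refine finsum_eq_sum_of_support_subset _ fun c => not_imp_comm.1 fun hc => ?_
  have partition_eq_zero (p : X) : partition X c p = 0 :=
    not_not.1 fun hp => hc (mem_partitionCharts hp)
  simp only [partition_eq_zero, Complex.ofReal_zero, zero_mul, MeasureTheory.integral_zero]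

variable {α β : ∀ p, TangentPlane X p [⋀^Fin 2]→ₗ[ℝ] ℂ}

theorem IsContinuousForm.continuousOn_chartIntegrand (hα : IsContinuousForm α) (c : X) :
    ContinuousOn (chartIntegrand c α) (chartAt ℂ c).target :=
  (Complex.continuous_ofReal.comp_continuousOn (continuousOn_partition_symm c)).mul
    ((hα c).comp (chartAt ℂ c).continuousOn_symm (chartAt ℂ c).mapsTo_symm)

theorem IsContinuousForm.integrableOn_chartIntegrand (hα : IsContinuousForm α) (c : X) :
    IntegrableOn (chartIntegrand c α) (chartAt ℂ c).target := by
  have compact : IsCompact (chartAt ℂ c '' tsupport (partition X c)) :=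
    (isClosed_tsupport _).isCompact.image_of_continuousOn
      ((chartAt ℂ c).continuousOn.mono (tsupport_partition_subset c))
  have subset_target : chartAt ℂ c '' tsupport (partition X c) ⊆ (chartAt ℂ c).target :=
    image_subset_iff.2 fun p hp => (chartAt ℂ c).map_source (tsupport_partition_subset c hp)
  refine ((hα.continuousOn_chartIntegrand c).mono subset_target).integrableOn_compact compact
    |>.of_forall_sdiff_eq_zero (chartAt ℂ c).open_target.measurableSet ?_
  rintro z ⟨hz, hz_support⟩
  have partition_eq_zero : partition X c ((chartAt ℂ c).symm z) = 0 :=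
    image_eq_zero_of_notMem_tsupport fun h => hz_support ⟨_, h, (chartAt ℂ c).right_inv hz⟩
  rw [chartIntegrand, partition_eq_zero, Complex.ofReal_zero, zero_mul]

theorem integral_add (hα : IsContinuousForm α) (hβ : IsContinuousForm β) :
    integral (α + β) = integral α + integral β := by
  simp only [integral_eq_sum, ← Finset.sum_add_distrib]
  refine Finset.sum_congr rfl fun c _ => ?_
  rw [← MeasureTheory.integral_add (hα.integrableOn_chartIntegrand c)
    (hβ.integrableOn_chartIntegrand c)]
  exact congrArg _ (funext fun z => mul_add _ _ _)

theorem integral_smul (k : ℂ) (α : ∀ p, TangentPlane X p [⋀^Fin 2]→ₗ[ℝ] ℂ) :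
    integral (k • α) = k * integral α := by
  simp only [integral_eq_sum, Finset.mul_sum]
  refine Finset.sum_congr rfl fun c _ => ?_
  rw [← MeasureTheory.integral_const_mul]
  exact congrArg _ (funext fun z => mul_left_comm _ _ _)

variable (σ : AreaForm X)

theorem integral_smulForm_conj (f : X → ℂ) :
    integral (σ.smulForm fun p => starRingEnd ℂ (f p)) =
      starRingEnd ℂ (integral (σ.smulForm f)) := by
  simp only [integral_eq_sum, map_sum]
  refine Finset.sum_congr rfl fun c _ => ?_
  rw [← _root_.integral_conj]
  refine congrArg _ (funext fun z => ?_)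
  simp only [chartIntegrand, AreaForm.smulForm, LinearMap.compAlternatingMap_apply,
    LinearMap.toSpanSingleton_apply, Complex.real_smul, map_mul, Complex.conj_ofReal]

/-- The summand, in the chart around `c`, of the integral of the real function `f` against the
area form, as a function of the coordinate. -/
def chartDensity (f : X → ℝ) (c : X) (z : ℂ) : ℝ :=
  partition X c ((chartAt ℂ c).symm z) *
    (σ.form ((chartAt ℂ c).symm z) (coordFrame c ((chartAt ℂ c).symm z)) *
      f ((chartAt ℂ c).symm z))

theorem chartIntegrand_smulForm_ofReal (f : X → ℝ) (c : X) (z : ℂ) :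
    chartIntegrand c (σ.smulForm fun p => (f p : ℂ)) z = (chartDensity σ f c z : ℂ) := by
  simp only [chartIntegrand, chartDensity, AreaForm.smulForm, LinearMap.compAlternatingMap_apply,
    LinearMap.toSpanSingleton_apply, Complex.real_smul, Complex.ofReal_mul]

theorem integral_smulForm_ofReal (f : X → ℝ) :
    integral (σ.smulForm fun p => (f p : ℂ)) =
      ((∑ c ∈ partitionCharts X, ∫ z in (chartAt ℂ c).target, chartDensity σ f c z : ℝ) : ℂ) := by
  simp only [integral_eq_sum, chartIntegrand_smulForm_ofReal, integral_complex_ofReal,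
    Complex.ofReal_sum]

variable {f : X → ℝ}

theorem chartDensity_nonneg (hf : ∀ p, 0 ≤ f p) (c : X) {z : ℂ} (hz : z ∈ (chartAt ℂ c).target) :
    0 ≤ chartDensity σ f c z :=
  mul_nonneg ((partition X).nonneg c _)
    (mul_nonneg (σ.pos c _ ((chartAt ℂ c).map_target hz)).le (hf _))

theorem integral_chartDensity_nonneg (hf : ∀ p, 0 ≤ f p) (c : X) :
    0 ≤ ∫ z in (chartAt ℂ c).target, chartDensity σ f c z :=
  setIntegral_nonneg (chartAt ℂ c).open_target.measurableSet fun _ hz =>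
    chartDensity_nonneg σ hf c hz

theorem re_integral_smulForm_nonneg (hf : ∀ p, 0 ≤ f p) :
    0 ≤ (integral (σ.smulForm fun p => (f p : ℂ))).re := by
  rw [integral_smulForm_ofReal, Complex.ofReal_re]
  exact Finset.sum_nonneg fun c _ => integral_chartDensity_nonneg σ hf c

theorem continuousOn_chartDensity (hf : Continuous f) (c : X) :
    ContinuousOn (chartDensity σ f c) (chartAt ℂ c).target :=
  (continuousOn_partition_symm c).mul
    (((σ.smooth c).continuousOn.mul hf.continuousOn).comp (chartAt ℂ c).continuousOn_symm
      (chartAt ℂ c).mapsTo_symm)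

theorem integrableOn_chartDensity (hf : Continuous f) (c : X) :
    IntegrableOn (chartDensity σ f c) (chartAt ℂ c).target := by
  have continuous_form : IsContinuousForm (σ.smulForm fun p => (f p : ℂ)) :=
    σ.isContinuousForm_smulForm (Complex.continuous_ofReal.comp hf)
  have h := (continuous_form.integrableOn_chartIntegrand c).re
  simpa only [IntegrableOn, chartIntegrand_smulForm_ofReal, RCLike.re_to_complex,
    Complex.ofReal_re] using h

theorem eq_zero_of_integral_chartDensity_eq_zero (hf : Continuous f) (hf0 : ∀ p, 0 ≤ f p)
    {c p : X} (hp : partition X c p ≠ 0)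
    (h : ∫ z in (chartAt ℂ c).target, chartDensity σ f c z = 0) : f p = 0 := by
  have mem_source : p ∈ (chartAt ℂ c).source := tsupport_partition_subset c (subset_tsupport _ hp)
  have density_ae_nonneg :
      0 ≤ᵐ[volume.restrict (chartAt ℂ c).target] chartDensity σ f c :=
    (ae_restrict_iff' (chartAt ℂ c).open_target.measurableSet).2
      (.of_forall fun _ hz => chartDensity_nonneg σ hf0 c hz)
  rw [setIntegral_eq_zero_iff_of_nonneg_ae density_ae_nonneg (integrableOn_chartDensity σ hf c)]
    at h
  have density_eq_zero : chartDensity σ f c (chartAt ℂ c p) = 0 :=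
    Measure.eqOn_open_of_ae_eq h (chartAt ℂ c).open_target (continuousOn_chartDensity σ hf c)
      continuousOn_const ((chartAt ℂ c).map_source mem_source)
  rw [chartDensity, (chartAt ℂ c).left_inv mem_source] at density_eq_zero
  exact ((mul_eq_zero.1 density_eq_zero).resolve_left hp |> mul_eq_zero.1).resolve_left
    (σ.pos c p mem_source).ne'

theorem eq_zero_of_re_integral_smulForm_eq_zero (hf : Continuous f) (hf0 : ∀ p, 0 ≤ f p)
    (h : (integral (σ.smulForm fun p => (f p : ℂ))).re = 0) : f = 0 := by
  rw [integral_smulForm_ofReal, Complex.ofReal_re, Finset.sum_eq_zero_iff_of_nonneg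
    fun c _ => integral_chartDensity_nonneg σ hf0 c] at h
  funext p
  obtain ⟨c, hc⟩ := (partition X).exists_pos_of_mem (mem_univ p)
  exact eq_zero_of_integral_chartDensity_eq_zero σ hf hf0 hc.ne'
    (h c (mem_partitionCharts hc.ne'))

end integration

section sections

variable {X : Type u} [TopologicalSpace X] [ChartedSpace ℂ X]
variable {E F G H : HermitianBundle.{u, v} X}

theorem trace_localRep (b p : X) (hb : p ∈ (E.triv b).baseSet) (A : E.Fiber p →L[ℂ] E.Fiber p) :
    LinearMap.trace ℂ _ (localRep E E b b p A).toLinearMap =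
      LinearMap.trace ℂ _ A.toLinearMap := by
  change LinearMap.trace ℂ _ ((((E.triv b).continuousLinearMapAt ℂ p).toLinearMap) ∘ₗ
    (A ∘L (E.triv b).symmL ℂ p).toLinearMap) = _
  rw [LinearMap.trace_comp_comm']
  change LinearMap.trace ℂ _
    (A ∘L ((E.triv b).symmL ℂ p ∘L (E.triv b).continuousLinearMapAt ℂ p)).toLinearMap = _
  rw [symm_comp_mapAt b p hb, ContinuousLinearMap.comp_id]

theorem IsSmoothHomOn.continuousOn_trace {U : Set X} {x : ∀ p, E.Fiber p →L[ℂ] E.Fiber p}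
    (hx : IsSmoothHomOn E E U x) :
    ContinuousOn (fun p => LinearMap.trace ℂ (E.Fiber p) (x p).toLinearMap) U := by
  have continuous_modelTrace : Continuous fun A : ModelFiber E.rank →L[ℂ] ModelFiber E.rank =>
      LinearMap.trace ℂ _ A.toLinearMap :=
    (LinearMap.trace ℂ (ModelFiber E.rank) ∘ₗ
      ContinuousLinearMap.coeLM ℂ).continuous_of_finiteDimensional
  intro p hp
  have hpb : p ∈ (E.triv p).baseSet := FiberBundle.mem_baseSet_trivializationAt' p
  have continuousOn_baseSet := (continuous_modelTrace.comp_continuousOn (hx p p).continuousOn).congr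
    (g := fun q => LinearMap.trace ℂ (E.Fiber q) (x q).toLinearMap)
    (fun q hq => (trace_localRep p q hq.2.1 (x q)).symm)
  have h := continuousOn_baseSet p ⟨hp, hpb, hpb⟩
  rw [inter_self] at h
  exact (continuousWithinAt_inter ((E.triv p).open_baseSet.mem_nhds hpb)).1 h

namespace HomSection

theorem continuous_trace (x : HomSection E E) : Continuous (trace x) :=
  continuousOn_univ.1 (IsSmoothHomOn.continuousOn_trace x.2)

theorem trace_add (x x' : HomSection E E) : trace (x + x') = trace x + trace x' :=
  funext fun p => map_add (LinearMap.trace ℂ (E.Fiber p)) (x.1 p).toLinearMap (x'.1 p).toLinearMap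

theorem trace_smul (k : ℂ) (x : HomSection E E) : trace (k • x) = k • trace x :=
  funext fun p => map_smul (LinearMap.trace ℂ (E.Fiber p)) k (x.1 p).toLinearMap

theorem trace_comp_comm (y : HomSection F E) (x : HomSection E F) :
    trace (comp y x) = trace (comp x y) :=
  funext fun p => LinearMap.trace_comp_comm' (x.1 p).toLinearMap (y.1 p).toLinearMap

theorem trace_adj (x : HomSection E E) :
    trace (adj x) = fun p => starRingEnd ℂ (trace x p) := by
  funext p
  simp only [trace, LinearMap.trace_eq_sum_inner _ (stdOrthonormalBasis ℂ (E.Fiber p)), map_sum]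
  refine Finset.sum_congr rfl fun i _ => ?_
  rw [inner_conj_symm]
  exact ContinuousLinearMap.adjoint_inner_right _ _ _

theorem comp_assoc (z : HomSection G H) (y : HomSection F G) (x : HomSection E F) :
    comp (comp z y) x = comp z (comp y x) := rfl

theorem add_comp (y y' : HomSection F G) (x : HomSection E F) :
    comp (y + y') x = comp y x + comp y' x := rfl

theorem sub_comp (y y' : HomSection F G) (x : HomSection E F) :
    comp (y - y') x = comp y x - comp y' x := rfl

theorem neg_comp (y : HomSection F G) (x : HomSection E F) : comp (-y) x = -comp y x := rfl

theorem smul_comp (k : ℂ) (y : HomSection F G) (x : HomSection E F) :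
    comp (k • y) x = k • comp y x := rfl

/-- Composition with a fixed section on the left, as a linear map. -/
def compLeftₗ (y : HomSection F G) : HomSection E F →ₗ[ℂ] HomSection E G where
  toFun := comp y
  map_add' _ _ := Subtype.ext (funext fun _ => ContinuousLinearMap.comp_add _ _ _)
  map_smul' _ _ := Subtype.ext (funext fun _ => ContinuousLinearMap.comp_smul _ _ _)

theorem comp_add (y : HomSection F G) (x x' : HomSection E F) :
    comp y (x + x') = comp y x + comp y x' :=
  map_add (compLeftₗ y) x x'

theorem comp_sub (y : HomSection F G) (x x' : HomSection E F) :
    comp y (x - x') = comp y x - comp y x' :=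
  map_sub (compLeftₗ y) x x'

theorem comp_neg (y : HomSection F G) (x : HomSection E F) : comp y (-x) = -comp y x :=
  map_neg (compLeftₗ y) x

theorem comp_smul (k : ℂ) (y : HomSection F G) (x : HomSection E F) :
    comp y (k • x) = k • comp y x :=
  map_smul (compLeftₗ y) k x

theorem comp_sum {ι : Type*} (s : Finset ι) (y : HomSection F G) (x : ι → HomSection E F) :
    comp y (∑ i ∈ s, x i) = ∑ i ∈ s, comp y (x i) :=
  map_sum (compLeftₗ y) x s

/-- The adjoint as a conjugate-linear map. -/
def adjₗ : HomSection E F →ₗ⋆[ℂ] HomSection F E where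
  toFun := adj
  map_add' _ _ := Subtype.ext (funext fun _ => map_add _ _ _)
  map_smul' _ _ := Subtype.ext (funext fun _ => LinearIsometryEquiv.map_smulₛₗ _ _ _)

theorem adj_add (x x' : HomSection E F) : adj (x + x') = adj x + adj x' :=
  map_add adjₗ x x'

theorem adj_sub (x x' : HomSection E F) : adj (x - x') = adj x - adj x' :=
  map_sub adjₗ x x'

theorem adj_neg (x : HomSection E F) : adj (-x) = -adj x :=
  map_neg adjₗ x

theorem adj_smul (k : ℂ) (x : HomSection E F) : adj (k • x) = starRingEnd ℂ k • adj x :=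
  map_smulₛₗ adjₗ k x

theorem adj_sum {ι : Type*} (s : Finset ι) (x : ι → HomSection E F) :
    adj (∑ i ∈ s, x i) = ∑ i ∈ s, adj (x i) :=
  map_sum adjₗ x s

theorem adj_adj (x : HomSection E F) : adj (adj x) = x :=
  Subtype.ext (funext fun _ => ContinuousLinearMap.adjoint_adjoint _)

theorem adj_comp (y : HomSection F G) (x : HomSection E F) :
    adj (comp y x) = comp (adj x) (adj y) :=
  Subtype.ext (funext fun _ => ContinuousLinearMap.adjoint_comp _ _)

/-- The pointwise squared Hilbert–Schmidt norm `tr (x x^*)`, computed for the adjoint `x^*` in an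
orthonormal basis. -/
def hilbertSchmidtSq (x : HomSection E F) (p : X) : ℝ :=
  ∑ i, ‖ContinuousLinearMap.adjoint (x.1 p) (stdOrthonormalBasis ℂ (F.Fiber p) i)‖ ^ 2

theorem hilbertSchmidtSq_nonneg (x : HomSection E F) (p : X) : 0 ≤ hilbertSchmidtSq x p :=
  Finset.sum_nonneg fun _ _ => sq_nonneg _

theorem trace_comp_adj (x : HomSection E F) :
    trace (comp x (adj x)) = fun p => (hilbertSchmidtSq x p : ℂ) := by
  funext p
  rw [trace, LinearMap.trace_eq_sum_inner _ (stdOrthonormalBasis ℂ (F.Fiber p)), hilbertSchmidtSq,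
    Complex.ofReal_sum]
  refine Finset.sum_congr rfl fun i _ => ?_
  rw [Complex.ofReal_pow, ← Complex.coe_algebraMap, ← inner_self_eq_norm_sq_to_K (𝕜 := ℂ)]
  exact (ContinuousLinearMap.adjoint_inner_left (x.1 p) _ _).symm

theorem continuous_hilbertSchmidtSq (x : HomSection E F) : Continuous (hilbertSchmidtSq x) := by
  have h := Complex.continuous_re.comp (continuous_trace (comp x (adj x)))
  simpa only [trace_comp_adj, Function.comp_def, Complex.ofReal_re] using h

theorem eq_zero_of_hilbertSchmidtSq_eq_zero {x : HomSection E F} (h : hilbertSchmidtSq x = 0) :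
    x = 0 := by
  refine Subtype.ext (funext fun p => ?_)
  have norm_sq_eq_zero := (Finset.sum_eq_zero_iff_of_nonneg fun _ _ => sq_nonneg _).1 (congrFun h p)
  have adjoint_eq_zero : ContinuousLinearMap.adjoint (x.1 p) = 0 :=
    ContinuousLinearMap.coe_injective ((stdOrthonormalBasis ℂ (F.Fiber p)).toBasis.ext fun i => by
      simpa using norm_sq_eq_zero i (Finset.mem_univ i))
  simpa using congrArg ContinuousLinearMap.adjoint adjoint_eq_zero

end HomSection

end sections

section area

open HomSection

variable {X : Type u} [TopologicalSpace X] [ChartedSpace ℂ X]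
variable {E F G : HermitianBundle.{u, v} X}

namespace AreaForm

variable (σ : AreaForm X)

theorem form_coordFrame_ne_zero (p : X) : σ.form p (coordFrame p p) ≠ 0 :=
  (σ.pos p p (mem_chart_source ℂ p)).ne'

theorem star_smul_form (y : HomTwoForm E F) (p : X) (w : Fin 2 → TangentPlane X p) :
    σ.form p w • (σ.star y).1 p = y.1 p w := by
  have h := alternating_ratio (σ.form p) (y.1 p) (coordFrame p p) w
  change σ.form p w • ((((σ.form p (coordFrame p p))⁻¹ : ℝ) : ℂ) • y.1 p (coordFrame p p)) = _
  rw [Complex.coe_smul, smul_comm]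
  exact (inv_smul_eq_iff₀ (σ.form_coordFrame_ne_zero p)).2 h.symm

/-- The two-form `x σ` attached to a section `x` of `Hom(E, F)`. -/
def mulForm (x : HomSection E F) : HomTwoForm E F :=
  ⟨fun p => LinearMap.compAlternatingMap (LinearMap.toSpanSingleton ℝ _ (x.1 p)) (σ.form p),
    fun c => IsSmoothHomOn.smul
      (Complex.ofRealCLM.contDiff.contMDiff.comp_contMDiffOn (σ.smooth c))
      (IsSmoothHomOn.mono (subset_univ _) x.2)⟩

/-- The Hodge star `y ↦ ⋆y` as a linear equivalence, with inverse `x ↦ x σ`. -/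
def starEquiv : HomTwoForm E F ≃ₗ[ℂ] HomSection E F where
  toFun := σ.star
  map_add' _ _ := Subtype.ext (funext fun _ => smul_add _ _ _)
  map_smul' _ _ := Subtype.ext (funext fun _ => smul_comm _ _ _)
  invFun := σ.mulForm
  left_inv y := Subtype.ext (funext fun p => AlternatingMap.ext (σ.star_smul_form y p))
  right_inv x := Subtype.ext (funext fun p => by
    change (((σ.form p (coordFrame p p))⁻¹ : ℝ) : ℂ) • σ.form p (coordFrame p p) • x.1 p = x.1 p
    rw [Complex.coe_smul, inv_smul_smul₀ (σ.form_coordFrame_ne_zero p)])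

theorem star_mulForm (x : HomSection E F) : σ.star (σ.mulForm x) = x :=
  σ.starEquiv.apply_symm_apply x

theorem star_inj {y y' : HomTwoForm E F} : σ.star y = σ.star y' ↔ y = y' :=
  σ.starEquiv.injective.eq_iff

theorem star_zero : σ.star (0 : HomTwoForm E F) = 0 :=
  map_zero (σ.starEquiv (E := E) (F := F))

theorem star_add (y y' : HomTwoForm E F) : σ.star (y + y') = σ.star y + σ.star y' :=
  map_add (σ.starEquiv (E := E) (F := F)) y y'

theorem star_sub (y y' : HomTwoForm E F) : σ.star (y - y') = σ.star y - σ.star y' :=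
  map_sub (σ.starEquiv (E := E) (F := F)) y y'

theorem star_neg (y : HomTwoForm E F) : σ.star (-y) = -σ.star y :=
  map_neg (σ.starEquiv (E := E) (F := F)) y

theorem star_smul (k : ℂ) (y : HomTwoForm E F) : σ.star (k • y) = k • σ.star y :=
  map_smul (σ.starEquiv (E := E) (F := F)) k y

theorem star_sum {ι : Type*} (s : Finset ι) (y : ι → HomTwoForm E F) :
    σ.star (∑ i ∈ s, y i) = ∑ i ∈ s, σ.star (y i) :=
  map_sum (σ.starEquiv (E := E) (F := F)) y s

theorem star_compLeft (x : HomSection F G) (y : HomTwoForm E F) :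
    σ.star (HomTwoForm.compLeft x y) = comp x (σ.star y) :=
  Subtype.ext (funext fun _ => (ContinuousLinearMap.comp_smul _ _ _).symm)

theorem star_compRight (y : HomTwoForm F G) (x : HomSection E F) :
    σ.star (HomTwoForm.compRight y x) = comp (σ.star y) x := rfl

theorem smulForm_trace_star (y : HomTwoForm E E) :
    σ.smulForm (trace (σ.star y)) = HomTwoForm.trace y := by
  refine funext fun p => AlternatingMap.ext fun w => ?_
  change σ.form p w • LinearMap.trace ℂ (E.Fiber p) ((σ.star y).1 p).toLinearMap =
    LinearMap.trace ℂ (E.Fiber p) (y.1 p w).toLinearMap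
  rw [← σ.star_smul_form y, ← Complex.coe_smul, ← Complex.coe_smul,
    ContinuousLinearMap.toLinearMap_smul, map_smul]

variable [CompactSpace X] [T2Space X] [IsManifold 𝓘(ℂ) ω X]

/-- The functional `x ↦ ∫_X tr(x) σ` on the sections of `End(E)`. -/
def intTrace : HomSection E E →ₗ[ℂ] ℂ where
  toFun x := integral (σ.smulForm (trace x))
  map_add' x y := by
    rw [trace_add, smulForm_add, integral_add (σ.isContinuousForm_smulForm (continuous_trace x))
      (σ.isContinuousForm_smulForm (continuous_trace y))]
  map_smul' k x := by
    rw [trace_smul, smulForm_smul, integral_smul, RingHom.id_apply, smul_eq_mul]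

theorem intTrace_apply (x : HomSection E E) :
    σ.intTrace x = integral (σ.smulForm (trace x)) := rfl

theorem integral_trace (y : HomTwoForm E E) :
    integral (HomTwoForm.trace y) = σ.intTrace (σ.star y) := by
  rw [intTrace_apply, smulForm_trace_star]

theorem intTrace_comp_comm (y : HomSection F E) (x : HomSection E F) :
    σ.intTrace (comp y x) = σ.intTrace (comp x y) := by
  simp only [intTrace_apply, trace_comp_comm y x]

theorem intTrace_comp_rotate (z : HomSection G E) (y : HomSection F G) (x : HomSection E F) :
    σ.intTrace (comp z (comp y x)) = σ.intTrace (comp y (comp x z)) := by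
  rw [intTrace_comp_comm, comp_assoc]

theorem intTrace_adj (x : HomSection E E) :
    σ.intTrace (adj x) = starRingEnd ℂ (σ.intTrace x) := by
  rw [intTrace_apply, intTrace_apply, trace_adj, integral_smulForm_conj]

/-- The `L²` inner product `⟨x, y⟩ = ∫_X tr (x y^*) σ` on the sections of `Hom(E, F)`; linear in the
first and conjugate-linear in the second variable, as in the symplectic form `omegaR`. -/
def l2Form : HomSection E F →ₗ[ℂ] HomSection E F →ₗ⋆[ℂ] ℂ :=
  LinearMap.mk₂'ₛₗ (RingHom.id ℂ) (starRingEnd ℂ) (fun x y => σ.intTrace (comp x (adj y)))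
    (fun x x' y => by rw [add_comp, map_add])
    (fun k x y => by rw [smul_comp, map_smul, RingHom.id_apply])
    (fun x y y' => by rw [adj_add, comp_add, map_add])
    (fun k x y => by rw [adj_smul, comp_smul, map_smul])

theorem l2Form_apply (x y : HomSection E F) :
    σ.l2Form x y = σ.intTrace (comp x (adj y)) := rfl

theorem conj_l2Form (x y : HomSection E F) : starRingEnd ℂ (σ.l2Form x y) = σ.l2Form y x := by
  rw [l2Form_apply, l2Form_apply, ← intTrace_adj, adj_comp, adj_adj]

theorem re_l2Form_self_nonneg (x : HomSection E F) : 0 ≤ (σ.l2Form x x).re := by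
  rw [l2Form_apply, intTrace_apply, trace_comp_adj]
  exact re_integral_smulForm_nonneg σ (hilbertSchmidtSq_nonneg x)

theorem eq_zero_of_re_l2Form_self_eq_zero {x : HomSection E F} (h : (σ.l2Form x x).re = 0) :
    x = 0 := by
  rw [l2Form_apply, intTrace_apply, trace_comp_adj] at h
  exact eq_zero_of_hilbertSchmidtSq_eq_zero (eq_zero_of_re_integral_smulForm_eq_zero σ
    (continuous_hilbertSchmidtSq x) (hilbertSchmidtSq_nonneg x) h)

theorem l2Form_comp_left (z : HomSection F G) (x : HomSection E F) (y : HomSection E G) :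
    σ.l2Form (comp z x) y = σ.l2Form x (comp (adj z) y) := by
  rw [l2Form_apply, l2Form_apply, adj_comp, adj_adj, comp_assoc, intTrace_comp_rotate]

theorem l2Form_comp_right (x : HomSection F G) (z : HomSection E F) (y : HomSection E G) :
    σ.l2Form (comp x z) y = σ.l2Form x (comp y (adj z)) := by
  rw [l2Form_apply, l2Form_apply, adj_comp, adj_adj, comp_assoc]

end AreaForm

end area

section gauge

open HomSection

variable {X : Type u} [TopologicalSpace X] [ChartedSpace ℂ X]
variable {E F G : HermitianBundle.{u, v} X}

theorem adj_gaugeHom (g : gaugeSubgroup E) : adj (gaugeHom g) = gaugeHom g⁻¹ := rfl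

theorem gaugeHom_inv_comp (g : gaugeSubgroup F) (x : HomSection E F) :
    comp (gaugeHom g⁻¹) (comp (gaugeHom g) x) = x :=
  Subtype.ext (funext fun p => congrArg (fun A : F.Fiber p →L[ℂ] F.Fiber p => A ∘L x.1 p)
    (Unitary.coe_star_mul_self (g.1 p)))

theorem adj_gaugeLie (θ : gaugeLie E) : adj θ.1 = -θ.1 :=
  Subtype.ext (funext θ.2)

/-- The action `x ↦ h x g⁻¹` of gauge transformations on the sections of `Hom(E, F)`. -/
def gaugeConj (h : gaugeSubgroup F) (g : gaugeSubgroup E) (x : HomSection E F) : HomSection E F :=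
  comp (comp (gaugeHom h) x) (gaugeHom g⁻¹)

theorem comp_gaugeConj (k : gaugeSubgroup G) (h : gaugeSubgroup F) (g : gaugeSubgroup E)
    (y : HomSection F G) (x : HomSection E F) :
    comp (gaugeConj k h y) (gaugeConj h g x) = gaugeConj k g (comp y x) := by
  simp only [gaugeConj, comp_assoc, gaugeHom_inv_comp]

theorem adj_gaugeConj (h : gaugeSubgroup F) (g : gaugeSubgroup E) (x : HomSection E F) :
    adj (gaugeConj h g x) = gaugeConj g h (adj x) := by
  simp only [gaugeConj, adj_comp, adj_gaugeHom, inv_inv, comp_assoc]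

theorem gaugeConj_sub (h : gaugeSubgroup F) (g : gaugeSubgroup E) (x x' : HomSection E F) :
    gaugeConj h g (x - x') = gaugeConj h g x - gaugeConj h g x' := by
  simp only [gaugeConj, comp_sub, sub_comp]

theorem gaugeConj_neg (h : gaugeSubgroup F) (g : gaugeSubgroup E) (x : HomSection E F) :
    gaugeConj h g (-x) = -gaugeConj h g x := by
  simp only [gaugeConj, comp_neg, neg_comp]

/-- The infinitesimal version `x ↦ η x - x θ` of `gaugeConj`. -/
def gaugeLieConj (η : gaugeLie F) (θ : gaugeLie E) (x : HomSection E F) : HomSection E F :=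
  comp η.1 x - comp x θ.1

theorem gaugeLieConj_neg (η : gaugeLie F) (θ : gaugeLie E) (x : HomSection E F) :
    gaugeLieConj η θ (-x) = -gaugeLieConj η θ x := by
  simp only [gaugeLieConj, comp_neg, neg_comp, neg_sub_neg, neg_sub]

theorem adj_gaugeLieConj (η : gaugeLie F) (θ : gaugeLie E) (x : HomSection E F) :
    adj (gaugeLieConj η θ x) = gaugeLieConj θ η (adj x) := by
  simp only [gaugeLieConj, adj_sub, adj_comp, adj_gaugeLie, comp_neg, neg_comp, sub_neg_eq_add,
    neg_add_eq_sub]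

theorem gaugeLieConj_gaugeAd (h : gaugeSubgroup F) (g : gaugeSubgroup E) (η : gaugeLie F)
    (θ : gaugeLie E) (x : HomSection E F) :
    gaugeLieConj (gaugeAd h η) (gaugeAd g θ) (gaugeConj h g x) =
      gaugeConj h g (gaugeLieConj η θ x) := by
  rw [gaugeLieConj, gaugeLieConj, gaugeConj_sub, ← comp_gaugeConj h h g, ← comp_gaugeConj h g g]
  rfl

variable [CompactSpace X] [T2Space X] [IsManifold 𝓘(ℂ) ω X] (σ : AreaForm X)

theorem AreaForm.l2Form_gaugeConj (h : gaugeSubgroup F) (g : gaugeSubgroup E)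
    (x y : HomSection E F) :
    σ.l2Form (gaugeConj h g x) (gaugeConj h g y) = σ.l2Form x y := by
  rw [l2Form_apply, adj_gaugeConj, comp_gaugeConj, gaugeConj, intTrace_comp_comm,
    gaugeHom_inv_comp, l2Form_apply]

theorem AreaForm.l2Form_gaugeLieConj (η : gaugeLie F) (θ : gaugeLie E) (x y : HomSection E F) :
    σ.l2Form (gaugeLieConj η θ x) y = -σ.l2Form x (gaugeLieConj η θ y) := by
  rw [gaugeLieConj, gaugeLieConj, map_sub, LinearMap.sub_apply, σ.l2Form_comp_left η.1 x y,
    σ.l2Form_comp_right x θ.1 y, adj_gaugeLie, adj_gaugeLie, neg_comp, comp_neg, map_neg, map_neg,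
    map_sub]
  ring

theorem AreaForm.l2Form_gaugeLieConj_eq_intTrace (η : gaugeLie F) (θ : gaugeLie E)
    (x y : HomSection E F) :
    σ.l2Form (gaugeLieConj η θ x) y =
      σ.intTrace (comp η.1 (comp x (adj y))) - σ.intTrace (comp θ.1 (comp (adj y) x)) := by
  rw [gaugeLieConj, map_sub, LinearMap.sub_apply, l2Form_apply, l2Form_apply, comp_assoc,
    comp_assoc, intTrace_comp_rotate σ x]

end gauge

section edgeRep

open HomSection

section commutator

variable {𝕜 M N : Type*} [NontriviallyNormedField 𝕜] [SeminormedAddCommGroup M] [NormedSpace 𝕜 M]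
  [SeminormedAddCommGroup N] [NormedSpace 𝕜 N]

theorem add_comp_sub_comp_add (B B' : N →L[𝕜] N) (C C' : M →L[𝕜] M) (A : M →L[𝕜] N) :
    (B + B') ∘L A - A ∘L (C + C') = (B ∘L A - A ∘L C) + (B' ∘L A - A ∘L C') := by
  rw [ContinuousLinearMap.add_comp, ContinuousLinearMap.comp_add, add_sub_add_comm]

theorem smul_comp_sub_comp_smul (k : 𝕜) (B : N →L[𝕜] N) (C : M →L[𝕜] M) (A : M →L[𝕜] N) :
    (k • B) ∘L A - A ∘L (k • C) = k • (B ∘L A - A ∘L C) := by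
  rw [ContinuousLinearMap.smul_comp, ContinuousLinearMap.comp_smul, smul_sub]

theorem comp_add_sub_add_comp (B : N →L[𝕜] N) (C : M →L[𝕜] M) (A A' : M →L[𝕜] N) :
    B ∘L (A + A') - (A + A') ∘L C = (B ∘L A - A ∘L C) + (B ∘L A' - A' ∘L C) := by
  rw [ContinuousLinearMap.comp_add, ContinuousLinearMap.add_comp, add_sub_add_comm]

theorem comp_smul_sub_smul_comp (k : 𝕜) (B : N →L[𝕜] N) (C : M →L[𝕜] M) (A : M →L[𝕜] N) :
    B ∘L (k • A) - (k • A) ∘L C = k • (B ∘L A - A ∘L C) := by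
  rw [ContinuousLinearMap.comp_smul, ContinuousLinearMap.smul_comp, smul_sub]

end commutator

variable {X : Type u} [TopologicalSpace X] [ChartedSpace ℂ X]
variable {V : Type*} [Quiver.{w + 1} V] {E : V → HermitianBundle.{u, v} X}

namespace EdgeRep

theorem ext_apply {z z' : EdgeRep E}
    (hx : ∀ i j (a : i ⟶ j) p, (z.x i j a).1 p = (z'.x i j a).1 p)
    (hy : ∀ i j (a : i ⟶ j) p t, (z.y i j a).1 p t = (z'.y i j a).1 p t) : z = z' :=
  EdgeRep.ext (funext₃ fun i j a => Subtype.ext (funext (hx i j a)))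
    (funext₃ fun i j a => Subtype.ext (funext fun p => AlternatingMap.ext (hy i j a p)))

theorem ext_star (σ : AreaForm X) {z z' : EdgeRep E}
    (hx : ∀ i j (a : i ⟶ j), z.x i j a = z'.x i j a)
    (hy : ∀ i j (a : i ⟶ j), σ.star (z.y i j a) = σ.star (z'.y i j a)) : z = z' :=
  EdgeRep.ext (funext₃ hx) (funext₃ fun i j a => σ.star_inj.1 (hy i j a))

variable (z z' : EdgeRep E) {i j : V} (a : i ⟶ j)

theorem add_x : (z + z').x i j a = z.x i j a + z'.x i j a := rfl

theorem add_y : (z + z').y i j a = z.y i j a + z'.y i j a := rfl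

theorem neg_x : (-z).x i j a = -z.x i j a := rfl

theorem neg_y : (-z).y i j a = -z.y i j a := rfl

theorem smul_x (k : ℂ) : (k • z).x i j a = k • z.x i j a := rfl

theorem smul_y (k : ℂ) : (k • z).y i j a = k • z.y i j a := rfl

theorem gauge_smul_x (g : GaugeGroup E) :
    (g • z).x i j a = gaugeConj (g j) (g i) (z.x i j a) := rfl

theorem star_gauge_smul_y (σ : AreaForm X) (g : GaugeGroup E) :
    σ.star ((g • z).y i j a) = gaugeConj (g i) (g j) (σ.star (z.y i j a)) := by
  rw [gaugeConj, ← σ.star_compLeft]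
  rfl

end EdgeRep

/-- The infinitesimal action `infAction` as a linear map from `𝔤` to the endomorphisms of the space
of edge representations. -/
def infActionₗ : GaugeAlgebra E →ₗ[ℝ] Module.End ℂ (EdgeRep E) :=
  LinearMap.mk₂' ℝ ℂ infAction
    (fun _ _ _ => EdgeRep.ext_apply (fun _ _ _ _ => add_comp_sub_comp_add _ _ _ _ _)
      fun _ _ _ _ _ => add_comp_sub_comp_add _ _ _ _ _)
    (fun _ _ _ => EdgeRep.ext_apply (fun _ _ _ _ => smul_comp_sub_comp_smul _ _ _ _)
      fun _ _ _ _ _ => smul_comp_sub_comp_smul _ _ _ _)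
    (fun _ _ _ => EdgeRep.ext_apply (fun _ _ _ _ => comp_add_sub_add_comp _ _ _ _)
      fun _ _ _ _ _ => comp_add_sub_add_comp _ _ _ _)
    (fun _ _ _ => EdgeRep.ext_apply (fun _ _ _ _ => comp_smul_sub_smul_comp _ _ _ _)
      fun _ _ _ _ _ => comp_smul_sub_smul_comp _ _ _ _)

theorem infActionₗ_x (θ : GaugeAlgebra E) (z : EdgeRep E) {i j : V} (a : i ⟶ j) :
    (infActionₗ θ z).x i j a = gaugeLieConj (θ j) (θ i) (z.x i j a) := rfl

theorem star_infActionₗ_y (σ : AreaForm X) (θ : GaugeAlgebra E) (z : EdgeRep E) {i j : V}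
    (a : i ⟶ j) :
    σ.star ((infActionₗ θ z).y i j a) = gaugeLieConj (θ i) (θ j) (σ.star (z.y i j a)) := by
  rw [gaugeLieConj, ← σ.star_compLeft, ← σ.star_compRight, ← σ.star_sub]
  rfl

theorem infActionₗ_ad (σ : AreaForm X) (g : GaugeGroup E) (θ : GaugeAlgebra E) (z : EdgeRep E) :
    infActionₗ (GaugeGroup.ad g θ) (g • z) = g • infActionₗ θ z := by
  refine EdgeRep.ext_star σ (fun i j a => ?_) (fun i j a => ?_)
  · exact gaugeLieConj_gaugeAd (g j) (g i) (θ j) (θ i) (z.x i j a)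
  · rw [star_infActionₗ_y, EdgeRep.star_gauge_smul_y, EdgeRep.star_gauge_smul_y, star_infActionₗ_y]
    exact gaugeLieConj_gaugeAd (g i) (g j) (θ i) (θ j) (σ.star (z.y i j a))

/-- The quaternionic structure `(x, y) ↦ ((⋆y)^*, -x^* σ)` on the space of edge representations,
through which the complex symplectic form is obtained from the `L²` Hermitian form. -/
def EdgeRep.quaternionic (σ : AreaForm X) : EdgeRep E →ₗ⋆[ℂ] EdgeRep E where
  toFun z := ⟨fun i j a => adj (σ.star (z.y i j a)), fun i j a => σ.mulForm (-adj (z.x i j a))⟩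
  map_add' z z' := EdgeRep.ext_star σ
    (fun i j a => by simp only [add_x, add_y, σ.star_add, adj_add])
    (fun i j a => by simp only [add_x, add_y, σ.star_add, σ.star_mulForm, adj_add, neg_add])
  map_smul' k z := EdgeRep.ext_star σ
    (fun i j a => by simp only [smul_x, smul_y, σ.star_smul, adj_smul])
    (fun i j a => by simp only [smul_x, smul_y, σ.star_smul, σ.star_mulForm, adj_smul, smul_neg])

namespace EdgeRep

variable (σ : AreaForm X) (z : EdgeRep E) {i j : V} (a : i ⟶ j)

theorem quaternionic_x : (quaternionic σ z).x i j a = adj (σ.star (z.y i j a)) := rfl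

theorem star_quaternionic_y : σ.star ((quaternionic σ z).y i j a) = -adj (z.x i j a) :=
  σ.star_mulForm _

theorem quaternionic_quaternionic : quaternionic σ (quaternionic σ z) = -z := by
  refine ext_star σ (fun i j a => ?_) (fun i j a => ?_)
  · rw [quaternionic_x, star_quaternionic_y, adj_neg, adj_adj, neg_x]
  · rw [star_quaternionic_y, quaternionic_x, adj_adj, neg_y, σ.star_neg]

theorem quaternionic_gauge_smul (g : GaugeGroup E) :
    quaternionic σ (g • z) = g • quaternionic σ z := by
  refine ext_star σ (fun i j a => ?_) (fun i j a => ?_)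
  · rw [quaternionic_x, star_gauge_smul_y, gauge_smul_x, quaternionic_x, adj_gaugeConj]
  · rw [star_quaternionic_y, gauge_smul_x, star_gauge_smul_y, star_quaternionic_y, adj_gaugeConj,
      gaugeConj_neg]

theorem quaternionic_infActionₗ (θ : GaugeAlgebra E) :
    quaternionic σ (infActionₗ θ z) = infActionₗ θ (quaternionic σ z) := by
  refine ext_star σ (fun i j a => ?_) (fun i j a => ?_)
  · rw [quaternionic_x, star_infActionₗ_y, infActionₗ_x, quaternionic_x, adj_gaugeLieConj]
  · rw [star_quaternionic_y, infActionₗ_x, star_infActionₗ_y, star_quaternionic_y,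
      adj_gaugeLieConj, gaugeLieConj_neg]

end EdgeRep

theorem adj_muR [Fintype V] [∀ i j : V, Fintype (i ⟶ j)] (σ : AreaForm X) (z : EdgeRep E) (i : V) :
    adj (muR σ z i) = muR σ z i := by
  simp only [muR, adj_sub, adj_sum, adj_comp, adj_adj]

variable [CompactSpace X] [T2Space X] [IsManifold 𝓘(ℂ) ω X] (σ : AreaForm X)

/-- The contribution of the edge `a` to the `L²` Hermitian form on the space of edge
representations. -/
def EdgeRep.edgeForm {i j : V} (a : i ⟶ j) : EdgeRep E →ₗ[ℂ] EdgeRep E →ₗ⋆[ℂ] ℂ :=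
  LinearMap.mk₂'ₛₗ (RingHom.id ℂ) (starRingEnd ℂ)
    (fun z w => σ.l2Form (z.x i j a) (w.x i j a) +
      σ.l2Form (σ.star (z.y i j a)) (σ.star (w.y i j a)))
    (fun z z' w => by
      simp only [add_x, add_y, σ.star_add, map_add, LinearMap.add_apply]
      abel)
    (fun k z w => by
      simp only [smul_x, smul_y, σ.star_smul, map_smul, LinearMap.smul_apply, smul_add,
        RingHom.id_apply])
    (fun z w w' => by
      simp only [add_x, add_y, σ.star_add, map_add]
      abel)
    (fun k z w => by simp only [smul_x, smul_y, σ.star_smul, map_smulₛₗ, smul_add])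

namespace EdgeRep

theorem re_edgeForm_self_nonneg (z : EdgeRep E) {i j : V} (a : i ⟶ j) :
    0 ≤ (edgeForm σ a z z).re :=
  add_nonneg (σ.re_l2Form_self_nonneg _) (σ.re_l2Form_self_nonneg _)

theorem eq_zero_of_re_edgeForm_self_eq_zero {z : EdgeRep E} {i j : V} {a : i ⟶ j}
    (h : (edgeForm σ a z z).re = 0) : z.x i j a = 0 ∧ σ.star (z.y i j a) = 0 :=
  ((add_eq_zero_iff_of_nonneg (σ.re_l2Form_self_nonneg _) (σ.re_l2Form_self_nonneg _)).1 h).imp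
    σ.eq_zero_of_re_l2Form_self_eq_zero σ.eq_zero_of_re_l2Form_self_eq_zero

end EdgeRep

variable [Fintype V] [∀ i j : V, Fintype (i ⟶ j)]

theorem sum_hom_eq_zero_iff {M : Type*} [AddCommMonoid M] [PartialOrder M] [IsOrderedAddMonoid M]
    {f : ∀ i j : V, (i ⟶ j) → M} (hf : ∀ i j a, 0 ≤ f i j a) :
    ∑ i, ∑ j, ∑ a : i ⟶ j, f i j a = 0 ↔ ∀ i j a, f i j a = 0 := by
  have nonneg_hom (i j : V) : 0 ≤ ∑ a, f i j a := Finset.sum_nonneg fun a _ => hf i j a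
  have nonneg_source (i : V) : 0 ≤ ∑ j, ∑ a, f i j a := Finset.sum_nonneg fun j _ => nonneg_hom i j
  simp only [Finset.sum_eq_zero_iff_of_nonneg, nonneg_source, nonneg_hom, hf, implies_true,
    Finset.mem_univ, forall_const]

/-- The `L²` Hermitian form on the space of edge representations; linear in the first and
conjugate-linear in the second variable, as in `omegaR`. -/
def EdgeRep.l2Form : EdgeRep E →ₗ[ℂ] EdgeRep E →ₗ⋆[ℂ] ℂ :=
  ∑ i, ∑ j, ∑ a : i ⟶ j, edgeForm σ a

namespace EdgeRep

theorem l2Form_apply (z w : EdgeRep E) :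
    l2Form σ z w = ∑ i, ∑ j, ∑ a : i ⟶ j, (σ.l2Form (z.x i j a) (w.x i j a) +
      σ.l2Form (σ.star (z.y i j a)) (σ.star (w.y i j a))) := by
  simp only [l2Form, LinearMap.sum_apply]
  rfl

theorem l2Form_definite (z : EdgeRep E) (h : l2Form σ z z = 0) : z = 0 := by
  have sum_re_eq_zero : ∑ i, ∑ j, ∑ a : i ⟶ j, (edgeForm σ a z z).re = 0 := by
    simpa only [l2Form, LinearMap.sum_apply, Complex.re_sum, Complex.zero_re] using
      congrArg Complex.re h
  have edge_eq_zero := fun i j a => eq_zero_of_re_edgeForm_self_eq_zero σ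
    ((sum_hom_eq_zero_iff fun i j a => re_edgeForm_self_nonneg σ z a).1 sum_re_eq_zero i j a)
  exact ext_star σ (fun i j a => (edge_eq_zero i j a).1)
    (fun i j a => (edge_eq_zero i j a).2.trans σ.star_zero.symm)

theorem isUnitaryAction :
    IsUnitaryAction GaugeGroup.ad (infActionₗ (E := E)) (l2Form σ) where
  conj_symm z w := by simp only [l2Form_apply, map_sum, map_add, σ.conj_l2Form]
  definite := l2Form_definite σ
  invariant g z w := by
    simp only [l2Form_apply, gauge_smul_x, star_gauge_smul_y, σ.l2Form_gaugeConj]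
  skew θ z w := by
    simp only [l2Form_apply, infActionₗ_x, star_infActionₗ_y, σ.l2Form_gaugeLieConj, ← neg_add,
      Finset.sum_neg_distrib]
  equivariant := infActionₗ_ad σ

theorem l2Form_quaternionic (z w : EdgeRep E) :
    l2Form σ z (quaternionic σ w) = ∑ i, ∑ j, ∑ a : i ⟶ j,
      (σ.intTrace (comp (z.x i j a) (σ.star (w.y i j a))) -
        σ.intTrace (comp (w.x i j a) (σ.star (z.y i j a)))) := by
  simp only [l2Form_apply, quaternionic_x, star_quaternionic_y, σ.l2Form_apply, adj_neg, adj_adj,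
    comp_neg, map_neg, ← sub_eq_add_neg, σ.intTrace_comp_comm (σ.star (z.y _ _ _))]

theorem isQuaternionicStructure :
    IsQuaternionicStructure (GaugeGroup E) (infActionₗ (E := E)) (l2Form σ) (quaternionic σ) where
  apply_apply := quaternionic_quaternionic σ
  alternating z := by simp only [l2Form_quaternionic, sub_self, Finset.sum_const_zero]
  map_group_smul g z := quaternionic_gauge_smul σ z g
  map_lie θ z := quaternionic_infActionₗ σ z θ

end EdgeRep

theorem omegaR_eq_two_mul_im_l2Form (z w : EdgeRep E) :
    omegaR σ z w = 2 * (EdgeRep.l2Form σ z w).im := by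
  simp only [omegaR, ← σ.intTrace_apply, map_add, EdgeRep.l2Form_apply, σ.l2Form_apply,
    σ.intTrace_comp_comm (adj _) (σ.star _)]

theorem omegaC_eq_l2Form_quaternionic (z w : EdgeRep E) :
    omegaC z w = EdgeRep.l2Form σ z (EdgeRep.quaternionic σ w) := by
  simp only [omegaC, σ.integral_trace, σ.star_sub, σ.star_compLeft, map_sub,
    EdgeRep.l2Form_quaternionic]

theorem sum_intTrace_comp_vertex (T : ∀ i, HomSection (E i) (E i))
    (P : ∀ i j : V, (i ⟶ j) → HomSection (E j) (E j))
    (Q : ∀ i j : V, (i ⟶ j) → HomSection (E i) (E i)) :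
    ∑ i, σ.intTrace (comp (T i) ((∑ j, ∑ a : j ⟶ i, P j i a) - ∑ j, ∑ a : i ⟶ j, Q i j a)) =
      ∑ i, ∑ j, ∑ a : i ⟶ j,
        (σ.intTrace (comp (T j) (P i j a)) - σ.intTrace (comp (T i) (Q i j a))) := by
  simp only [comp_sub, comp_sum, map_sub, map_sum, Finset.sum_sub_distrib]
  rw [Finset.sum_comm]

theorem pairR_muR (z : EdgeRep E) (θ : GaugeAlgebra E) :
    pairR σ (muR σ z) θ = (EdgeRep.l2Form σ (infActionₗ θ z) z).im := by
  simp only [pairR, muR, ← σ.intTrace_apply, sum_intTrace_comp_vertex, EdgeRep.l2Form_apply,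
    infActionₗ_x, star_infActionₗ_y, σ.l2Form_gaugeLieConj_eq_intTrace]
  simp only [comp_sub, map_sub]
  refine congrArg Complex.im (Finset.sum_congr rfl fun i _ => Finset.sum_congr rfl fun j _ =>
    Finset.sum_congr rfl fun a _ => ?_)
  ring

theorem two_mul_pairC_muC (z : EdgeRep E) (θ : GaugeAlgebra E) :
    2 * pairC (muC z) θ = EdgeRep.l2Form σ (infActionₗ θ z) (EdgeRep.quaternionic σ z) := by
  simp only [pairC, muC, σ.integral_trace, σ.star_compLeft, σ.star_sub, σ.star_sum,
    σ.star_compRight, sum_intTrace_comp_vertex, EdgeRep.l2Form_apply, infActionₗ_x,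
    star_infActionₗ_y, EdgeRep.quaternionic_x, EdgeRep.star_quaternionic_y,
    σ.l2Form_gaugeLieConj_eq_intTrace, adj_neg, adj_adj, comp_neg, neg_comp, map_neg,
    Finset.mul_sum]
  refine Finset.sum_congr rfl fun i _ => Finset.sum_congr rfl fun j _ =>
    Finset.sum_congr rfl fun a _ => ?_
  ring

theorem isHamiltonianAction_omegaR :
    IsHamiltonianAction ℝ GaugeGroup.ad (infAction (E := E)) (omegaR σ)
      (fun z θ => pairR σ (muR σ z) θ) := by
  simp only [funext₂ (omegaR_eq_two_mul_im_l2Form σ), pairR_muR]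
  exact (EdgeRep.isUnitaryAction σ).isHamiltonianAction_two_mul_im

theorem isHamiltonianAction_omegaC (σ : AreaForm X) :
    IsHamiltonianAction ℂ GaugeGroup.ad (infAction (E := E)) omegaC
      (fun z θ => pairC (muC z) θ) := by
  rw [funext₂ (omegaC_eq_l2Form_quaternionic σ)]
  exact (EdgeRep.isUnitaryAction σ).isHamiltonianAction_quaternionic
    (EdgeRep.isQuaternionicStructure σ) (two_mul_pairC_muC σ)

end edgeRep

section infinitesimal

theorem hasDerivAt_exp_smul_comp_exp_neg_smul {𝕜 M N : Type*} [RCLike 𝕜]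
    [NormedAddCommGroup M] [NormedSpace 𝕜 M] [CompleteSpace M]
    [NormedAddCommGroup N] [NormedSpace 𝕜 N] [CompleteSpace N]
    (B : N →L[𝕜] N) (C : M →L[𝕜] M) (A : M →L[𝕜] N) :
    HasDerivAt (fun t : 𝕜 => NormedSpace.exp (t • B) ∘L A ∘L NormedSpace.exp (t • -C))
      (B ∘L A - A ∘L C) 0 := by
  have deriv_left := hasDerivAt_exp_smul_const (𝕂 := 𝕜) B (0 : 𝕜)
  have deriv_right := hasDerivAt_exp_smul_const (𝕂 := 𝕜) (-C) (0 : 𝕜)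
  refine (deriv_left.clm_comp ((hasDerivAt_const 0 A).clm_comp deriv_right)).congr_deriv ?_
  simp only [zero_smul, NormedSpace.exp_zero, one_mul]
  simp only [ContinuousLinearMap.one_def, ContinuousLinearMap.comp_id, ContinuousLinearMap.id_comp,
    ContinuousLinearMap.comp_neg, zero_add, sub_eq_add_neg]

variable {X : Type u} [TopologicalSpace X] [ChartedSpace ℂ X]
variable {E F : HermitianBundle.{u, v} X}

theorem gaugeExp_inv (θ : gaugeLie E) : (gaugeExp θ)⁻¹ = gaugeExp (-θ) := by
  refine Subtype.ext (funext fun p => Subtype.ext ?_)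
  change star (NormedSpace.exp (θ.1.1 p)) = NormedSpace.exp (-θ.1.1 p)
  rw [NormedSpace.star_exp, θ.2 p]

theorem hasDerivAt_gaugeConj_gaugeExp (η : gaugeLie F) (θ : gaugeLie E) (p : X)
    (A : E.Fiber p →L[ℂ] F.Fiber p) :
    HasDerivAt (fun t : ℝ => (gaugeHom (gaugeExp (t • η))).1 p ∘L A ∘L
      (gaugeHom (gaugeExp (t • θ))⁻¹).1 p) (η.1.1 p ∘L A - A ∘L θ.1.1 p) 0 := by
  simp only [gaugeExp_inv, ← smul_neg]
  have h := hasDerivAt_exp_smul_comp_exp_neg_smul (η.1.1 p) (θ.1.1 p) A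
  rw [← Complex.ofReal_zero] at h
  refine (h.scomp (0 : ℝ) Complex.ofRealCLM.hasDerivAt).congr_deriv ?_
  rw [Complex.ofRealCLM_apply, Complex.ofReal_one, one_smul]

end infinitesimal

end QuiverBundle

theorem mainTheorem3 {X : Type*} [TopologicalSpace X] [T2Space X] [CompactSpace X]
    [ChartedSpace ℂ X] [IsManifold 𝓘(ℂ) ω X] (σ : QuiverBundle.AreaForm X)
    {V : Type*} [Fintype V] [Quiver V] [∀ i j : V, Fintype (i ⟶ j)]
    (E : V → QuiverBundle.HermitianBundle X) :
    -- `infAction θ` is the vector field `d/dt|₀ exp (t θ) · z`, pointwise on `X`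
    (∀ (θ : QuiverBundle.GaugeAlgebra E) (z : QuiverBundle.EdgeRep E) (i j : V) (a : i ⟶ j)
      (p : X),
      HasDerivAt (fun t : ℝ => ((t • θ).exp • z).x i j a |>.1 p)
        ((QuiverBundle.infAction θ z).x i j a |>.1 p) 0 ∧
      ∀ w : Fin 2 → QuiverBundle.TangentPlane X p,
        HasDerivAt (fun t : ℝ => ((t • θ).exp • z).y i j a |>.1 p w)
          ((QuiverBundle.infAction θ z).y i j a |>.1 p w) 0) ∧
    -- the components of the real moment map are self-adjoint
    (∀ (z : QuiverBundle.EdgeRep E) (i : V),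
      QuiverBundle.HomSection.adj (QuiverBundle.muR σ z i) = QuiverBundle.muR σ z i) ∧
    -- the action is Hamiltonian for the real symplectic form, with moment map `muR`
    QuiverBundle.IsHamiltonianAction ℝ QuiverBundle.GaugeGroup.ad
      (QuiverBundle.infAction (E := E)) (QuiverBundle.omegaR σ)
      (fun z θ => QuiverBundle.pairR σ (QuiverBundle.muR σ z) θ) ∧
    -- and for the complex symplectic form, with moment map `muC`
    QuiverBundle.IsHamiltonianAction ℂ QuiverBundle.GaugeGroup.ad
      (QuiverBundle.infAction (E := E)) QuiverBundle.omegaC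
      (fun z θ => QuiverBundle.pairC (QuiverBundle.muC z) θ) := by
  refine ⟨fun θ z i j a p => ⟨?_, fun w => ?_⟩, QuiverBundle.adj_muR σ,
    QuiverBundle.isHamiltonianAction_omegaR σ, QuiverBundle.isHamiltonianAction_omegaC σ⟩
  · exact QuiverBundle.hasDerivAt_gaugeConj_gaugeExp (θ j) (θ i) p ((z.x i j a).1 p)
  · exact QuiverBundle.hasDerivAt_gaugeConj_gaugeExp (θ i) (θ j) p ((z.y i j a).1 p w)
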